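/- Let $q$ be a prime power, let $\mathbb{F}_{q^m}/\mathbb{F}_q$ be an extension of degree $m$ of finite fields with trace $\mathrm{Tr}$, let $s\ge 1$ and $1\le \ell_1<\ell_2<\cdots<\ell_s<\frac m2$ be integers, and let $\mathcal{L}=\langle x^{q^{\ell_1}},\ldots,x^{q^{\ell_s}}\rangle$ be the $\mathbb{F}_{q^m}$-subspace of $\mathbb{F}_{q^m}[x]$ spanned by these monomials. For $R\in\mathcal{L}$ let $Q_R(x)=\mathrm{Tr}(xR(x))$, a quadratic form on the $\mathbb{F}_q$-space $\mathbb{F}_{q^m}$. The rank of a quadratic form is the least number of variables (linear forms) in which it can be written. A quadratic form of even rank $r$ is of type $1$ if in suitable linear coordinates it is $x_1x_2+\cdots+x_{r-1}x_r$, and of type $3$ if $r\ge 2$ and in suitable linear coordinates it is $x_1x_2+\cdots+x_{r-3}x_{r-2}+(x_{r-1}^2+a\,x_{r-1}x_r+b\,x_r^2)$ with $a,b\in\mathbb{F}_q$ such that the binary form in brackets has only the trivial zero over $\mathbb{F}_q$. Put $$M_r=\#\{R\in\mathcal{L}: Q_R \text{ has rank } r\},\qquad R_{\mathcal{L}}=\{r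 : M_r>0\},$$ and let $M_{r,1}$ (resp. $M_{r,2}$) be the number of $R\in\mathcal{L}\smallsetminus\{0\}$ such that $Q_R$ has rank $r$ and is of type $1$ (resp. of type $3$). Consider the codes of length $q^m-1$ over $\mathbb{F}_q$ $$\mathcal{C}_{\mathcal{L},1}=\big\{\big(\mathrm{Tr}(xR(x)+\beta x)\big)_{x\in\mathbb{F}_{q^m}^*}: R\in\mathcal{L},\ \beta\in\mathbb{F}_{q^m}\big\},$$ $$\mathcal{C}_{\mathcal{L},2}=\big\{\big(\mathrm{Tr}(xR(x)+\beta x)+b\big)_{x\in\mathbb{F}_{q^m}^*}: R\in\mathcal{L},\ \beta\in\mathbb{F}_{q^m},\ b\in\mathbb{F}_q\big\}.$$ Suppose that $\mathcal{L}$ is an even rank family, i.e. $Q_R$ has even rank for every $R\in\mathcal{L}$. Then $\mathcal{C}_{\mathcal{L},1}$ and $\mathcal{C}_{\mathcal{L},2}$ are cyclic codes (the coordinates being ordered as $x=1,\alpha,\alpha^2,\ldots,\alpha^{q^m-2}$ for a generator $\alpha$ of $\mathbb{F}_{q^m}^*$), their dimensions over $\mathbb{F}_q$ are $m(s+1)$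 and $m(s+1)+1$ respectively, and their weight distributions are given by the following tables, where $r$ runs over $R_{\mathcal{L}}$ and $i$ over $\{1,2\}$, and where the number of words of weight $w$ is the sum of the frequencies of all the rows whose weight equals $w$ (rows with frequency $0$ contribute nothing; in particular $M_{0,i}=0$). Weight distribution of $\mathcal{C}_{\mathcal{L},1}$: $$\begin{array}{l|l} \text{weight} & \text{frequency}\\ \hline 0 & 1\\ q^m-q^{m-1} & \sum_{r\in R_{\mathcal{L}}}M_r(q^m-q^r)\\ q^m-q^{m-1}+(-1)^i(q-1)q^{m-\frac r2-1} & M_{r,i}\big(q^{r-1}+(-1)^{i+1}(q-1)q^{\frac r2-1}\big)\\ q^m-q^{m-1}+(-1)^{i+1}q^{m-\frac r2-1} & M_{r,i}\big(q^{r-1}+(-1)^{i}q^{\frac r2-1}\big)(q-1) \end{array}$$ Weight distribution of $\mathcal{C}_{\mathcal{L},2}$: all the rows of the previous table, and in addition $$\begin{array}{l|l} \text{weight} & \text{frequency}\\ \hline q^m-1 & q-1\\ q^m-q^{m-1}-1 & (q-1)\sum_{r\in R_{\mathcal{L}}}M_r(q^m-q^r)\\ q^m-q^{m-1}-1+(-1)^i(q-1)q^{m-\frac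 r2-1} & M_{r,i}\big(q^{r-1}+(-1)^{i}q^{\frac r2-1}\big)(q-1)\\ q^m-q^{m-1}-1+(-1)^{i+1}q^{m-\frac r2-1} & M_{r,i}\big(q^{r}-q^{r-1}+(-1)^{i+1}q^{\frac r2-1}\big)(q-1) \end{array}$$ -/

import Mathlib

open Polynomial

noncomputable section

/-- The rank of a quadratic form `Q : F → K` on a finite dimensional `K`-space `F`: the least number
of variables (linear forms on `F`) needed to write `Q` as a quadratic form in these variables. -/
def qfRank (K : Type*) {F : Type*} [Field K] [Field F] [Algebra K F] (Q : F → K) : ℕ :=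
  sInf {r : ℕ | ∃ (f : F →ₗ[K] (Fin r → K)) (P : QuadraticForm K (Fin r → K)), ∀ x, Q x = P (f x)}

/-- Type `1`: in suitable linear coordinates `Q` is the hyperbolic form `∑ u_j v_j`
(the coordinates `u_j`, `v_j` being part of a basis of the dual space). -/
def IsTypeOne (K : Type*) {F : Type*} [Field K] [Field F] [Algebra K F] (Q : F → K) : Prop :=
  ∃ (k : ℕ) (u v : Fin k → Module.Dual K F), LinearIndependent K (Sum.elim u v) ∧
    ∀ x, Q x = ∑ j, u j x * v j x

/-- Type `3`: in suitable linear coordinates `Q` is `∑ u_j v_j + (y² + a y z + b z²)`, where the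
binary form `y² + a y z + b z²` is anisotropic. -/
def IsTypeThree (K : Type*) {F : Type*} [Field K] [Field F] [Algebra K F] (Q : F → K) : Prop :=
  ∃ (k : ℕ) (u v : Fin k → Module.Dual K F) (e : Fin 2 → Module.Dual K F) (a b : K),
    LinearIndependent K (Sum.elim (Sum.elim u v) e) ∧
    (∀ y z : K, y ^ 2 + a * y * z + b * z ^ 2 = 0 → y = 0 ∧ z = 0) ∧
    ∀ x, Q x = ∑ j, u j x * v j x + (e 0 x ^ 2 + a * e 0 x * e 1 x + b * e 1 x ^ 2)

/-- The index `i = 1` stands for type `1`, the index `i = 2` for type `3`. -/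
def HasTypeIndex (K : Type*) {F : Type*} [Field K] [Field F] [Algebra K F] (Q : F → K) :
    ℕ → Prop
  | 1 => IsTypeOne K Q
  | 2 => IsTypeThree K Q
  | _ => False

/-- `Q_R(x) = Tr(x R(x))`. -/
def traceForm (K : Type*) {F : Type*} [Field K] [Field F] [Algebra K F] (R : F[X]) (x : F) : K :=
  Algebra.trace K F (x * R.eval x)

/-- The `F`-span of `x^(q^ℓ₁), …, x^(q^ℓₛ)` in `F[x]`, with `q = |K|`. -/
def linearizedSpan (K F : Type*) [Field K] [Fintype K] [Field F] {s : ℕ} (ℓ : Fin s → ℕ) :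
    Submodule F F[X] :=
  Submodule.span F (Set.range fun i => (X : F[X]) ^ (Fintype.card K ^ ℓ i))

/-- All the forms `Q_R`, `R ∈ L`, have even rank. -/
def IsEvenRankFamily (K : Type*) {F : Type*} [Field K] [Field F] [Algebra K F]
    (L : Submodule F F[X]) : Prop :=
  ∀ R ∈ L, Even (qfRank K (traceForm K R))

/-- The set of ranks `R_L`. -/
def rankSet (K : Type*) {F : Type*} [Field K] [Field F] [Algebra K F]
    (L : Submodule F F[X]) : Set ℕ :=
  {r | ∃ R ∈ L, qfRank K (traceForm K R) = r}

/-- `M_r`. -/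
def rankCount (K : Type*) {F : Type*} [Field K] [Field F] [Algebra K F]
    (L : Submodule F F[X]) (r : ℕ) : ℕ :=
  Set.ncard {R : F[X] | R ∈ L ∧ qfRank K (traceForm K R) = r}

/-- `M_{r,i}`. -/
def rankTypeCount (K : Type*) {F : Type*} [Field K] [Field F] [Algebra K F]
    (L : Submodule F F[X]) (r i : ℕ) : ℕ :=
  Set.ncard {R : F[X] | R ∈ L ∧ R ≠ 0 ∧ qfRank K (traceForm K R) = r ∧
    HasTypeIndex K (traceForm K R) i}

/-- The word `c_{R,b}(β) = (Tr(x R(x) + β x) + b)`, with coordinates indexed by `x ∈ F^*`. -/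
def codeword (K : Type*) {F : Type*} [Field K] [Field F] [Algebra K F]
    (R : F[X]) (β : F) (b : K) : Fˣ → K :=
  fun x => Algebra.trace K F ((x : F) * R.eval (x : F) + β * (x : F)) + b

theorem codeword_add (K : Type*) {F : Type*} [Field K] [Field F] [Algebra K F]
    (R R' : F[X]) (β β' : F) (b b' : K) :
    codeword K (R + R') (β + β') (b + b') = codeword K R β b + codeword K R' β' b' := by
  funext x
  simp only [codeword, Pi.add_apply, eval_add, mul_add, add_mul, map_add]
  ring

theorem codeword_zero (K : Type*) {F : Type*} [Field K] [Field F] [Algebra K F] :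
    codeword K (0 : F[X]) 0 0 = 0 := by
  funext x
  simp [codeword]

theorem codeword_smul (K : Type*) {F : Type*} [Field K] [Field F] [Algebra K F]
    (a : K) (R : F[X]) (β : F) (b : K) :
    codeword K (algebraMap K F a • R) (algebraMap K F a * β) (a * b) = a • codeword K R β b := by
  funext x
  have h : (x : F) * (algebraMap K F a • R).eval (x : F) + algebraMap K F a * β * (x : F)
      = a • ((x : F) * R.eval (x : F) + β * (x : F)) := by
    rw [eval_smul, smul_eq_mul, Algebra.smul_def]
    ring
  simp only [codeword, Pi.smul_apply, h, map_smul, smul_eq_mul]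
  ring

/-- The code `C_{L,1}`, of length `|F^*|`. -/
def codeOne (K : Type*) {F : Type*} [Field K] [Field F] [Algebra K F]
    (L : Submodule F F[X]) : Submodule K (Fˣ → K) where
  carrier := {c | ∃ R ∈ L, ∃ β : F, c = codeword K R β 0}
  add_mem' := by
    rintro _ _ ⟨R, hR, β, rfl⟩ ⟨R', hR', β', rfl⟩
    exact ⟨R + R', L.add_mem hR hR', β + β', by rw [← codeword_add, add_zero]⟩
  zero_mem' := ⟨0, L.zero_mem, 0, (codeword_zero K).symm⟩
  smul_mem' := by
    rintro a _ ⟨R, hR, β, rfl⟩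
    exact ⟨_, L.smul_mem (algebraMap K F a) hR, algebraMap K F a * β, by
      rw [← codeword_smul, mul_zero]⟩

/-- The code `C_{L,2}`, of length `|F^*|`. -/
def codeTwo (K : Type*) {F : Type*} [Field K] [Field F] [Algebra K F]
    (L : Submodule F F[X]) : Submodule K (Fˣ → K) where
  carrier := {c | ∃ R ∈ L, ∃ (β : F) (b : K), c = codeword K R β b}
  add_mem' := by
    rintro _ _ ⟨R, hR, β, b, rfl⟩ ⟨R', hR', β', b', rfl⟩
    exact ⟨R + R', L.add_mem hR hR', β + β', b + b', by rw [← codeword_add]⟩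
  zero_mem' := ⟨0, L.zero_mem, 0, 0, (codeword_zero K).symm⟩
  smul_mem' := by
    rintro a _ ⟨R, hR, β, b, rfl⟩
    exact ⟨_, L.smul_mem (algebraMap K F a) hR, algebraMap K F a * β, a * b, by
      rw [← codeword_smul]⟩

/-- Cyclicity of a code whose coordinates are ordered as `1, α, α², …`, for every generator `α` of
`F^*`: the cyclic shift of a word is again a word. -/
def IsCyclicCode {K F : Type*} [Field K] [Field F] (C : Submodule K (Fˣ → K)) : Prop :=
  ∀ α : Fˣ, (∀ x : Fˣ, x ∈ Subgroup.zpowers α) → ∀ c ∈ C, (fun x : Fˣ => c (α⁻¹ * x)) ∈ C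

/-- The frequency `A_w`: the number of words of Hamming weight `w`. -/
def weightFreq {K ι : Type*} [Field K] [DecidableEq K] [Fintype ι]
    (C : Submodule K (ι → K)) (w : ℕ) : ℕ :=
  Set.ncard {c : ι → K | c ∈ C ∧ hammingNorm c = w}

/-- The contribution to `A_w` of the row of a table with the given weight and frequency. The
frequency `A_w` described by a table is the sum of the contributions of its rows, so that the
frequencies of rows with the same weight are added. -/
def tableRow (weight freq : ℚ) (w : ℕ) : ℚ :=
  if (w : ℚ) = weight then freq else 0

/-- The weight distribution of `C_{L,1}`; `q` is the size of the field of constants, `Rset` the set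
of ranks, `M r = M_r` and `Mi r i = M_{r,i}`. -/
def tableOne (q m : ℕ) (Rset : Set ℕ) (M : ℕ → ℕ) (Mi : ℕ → ℕ → ℕ) (w : ℕ) : ℚ :=
  tableRow 0 1 w
  + tableRow ((q : ℚ) ^ m - (q : ℚ) ^ ((m : ℤ) - 1))
      (∑ᶠ r ∈ Rset, (M r : ℚ) * ((q : ℚ) ^ m - (q : ℚ) ^ r)) w
  + ∑ᶠ r ∈ Rset, ∑ i ∈ ({1, 2} : Finset ℕ),
    (tableRow
        ((q : ℚ) ^ m - (q : ℚ) ^ ((m : ℤ) - 1)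
          + (-1) ^ i * ((q : ℚ) - 1) * (q : ℚ) ^ ((m : ℤ) - (r : ℤ) / 2 - 1))
        ((Mi r i : ℚ) * ((q : ℚ) ^ ((r : ℤ) - 1)
          + (-1) ^ (i + 1) * ((q : ℚ) - 1) * (q : ℚ) ^ ((r : ℤ) / 2 - 1))) w
      + tableRow
        ((q : ℚ) ^ m - (q : ℚ) ^ ((m : ℤ) - 1)
          + (-1) ^ (i + 1) * (q : ℚ) ^ ((m : ℤ) - (r : ℤ) / 2 - 1))
        ((Mi r i : ℚ) * ((q : ℚ) ^ ((r : ℤ) - 1)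
          + (-1) ^ i * (q : ℚ) ^ ((r : ℤ) / 2 - 1)) * ((q : ℚ) - 1)) w)

/-- The weight distribution of `C_{L,2}`: the rows for `C_{L,1}` and those of the words with
`b ≠ 0`. -/
def tableTwo (q m : ℕ) (Rset : Set ℕ) (M : ℕ → ℕ) (Mi : ℕ → ℕ → ℕ) (w : ℕ) : ℚ :=
  tableOne q m Rset M Mi w
  + tableRow ((q : ℚ) ^ m - 1) ((q : ℚ) - 1) w
  + tableRow ((q : ℚ) ^ m - (q : ℚ) ^ ((m : ℤ) - 1) - 1)
      (((q : ℚ) - 1) * ∑ᶠ r ∈ Rset, (M r : ℚ) * ((q : ℚ) ^ m - (q : ℚ) ^ r)) w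
  + ∑ᶠ r ∈ Rset, ∑ i ∈ ({1, 2} : Finset ℕ),
    (tableRow
        ((q : ℚ) ^ m - (q : ℚ) ^ ((m : ℤ) - 1) - 1
          + (-1) ^ i * ((q : ℚ) - 1) * (q : ℚ) ^ ((m : ℤ) - (r : ℤ) / 2 - 1))
        ((Mi r i : ℚ) * ((q : ℚ) ^ ((r : ℤ) - 1)
          + (-1) ^ i * (q : ℚ) ^ ((r : ℤ) / 2 - 1)) * ((q : ℚ) - 1)) w
      + tableRow
        ((q : ℚ) ^ m - (q : ℚ) ^ ((m : ℤ) - 1) - 1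
          + (-1) ^ (i + 1) * (q : ℚ) ^ ((m : ℤ) - (r : ℤ) / 2 - 1))
        ((Mi r i : ℚ) * ((q : ℚ) ^ r - (q : ℚ) ^ ((r : ℤ) - 1)
          + (-1) ^ (i + 1) * (q : ℚ) ^ ((r : ℤ) / 2 - 1)) * ((q : ℚ) - 1)) w)

end

/-!
The number of zeros of `Q + φ + b`, for `Q` of even rank `r`, depends only on `r`, on the type of
`Q` and on the linear form `φ`. If `φ` is not constant on the cosets of the radical of `Q`, a
translation along the radical shows that all values are equally frequent. If it is, then `φ` is
`y ↦ B(c, y)`, for the polar form `B` of `Q` and a vector `c` that is unique modulo the radical;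
completing the square turns the equation into `Q(y) = Q(c) - b`. The number of solutions is known
from the Witt decomposition of `Q` into hyperbolic planes and, for type `3`, one norm form of a
quadratic extension, and so is the number of `c` for each value of `Q(c)`. Since the trace form is
nondegenerate, `Tr(β x)` runs once over all linear forms `φ`, and summing over `β` and `R` gives
the tables.

The parametrization of the codes is injective because `2 ℓᵢ < m`: the polar form of `Q_R` is
`Tr(y (R(x) + R*(x)))`, where the exponents `q ^ ℓᵢ` of `R` and `q ^ (m - ℓᵢ)` of its adjoint `R*`
are all distinct, so by the independence of characters it vanishes only for `R = 0`.
-/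

section Reduction

open Module QuadraticMap

variable {R V W X Y : Type*} [CommRing R] [AddCommGroup V] [Module R V] [AddCommGroup W]
  [Module R W] [AddCommGroup X] [Module R X] [AddCommGroup Y] [Module R Y]

/-- `Q` is the function `P` in suitable linear coordinates: the pullback of `P` along a surjective
linear map. For a quadratic form `P` without radical, the kernel of this map is the radical of
`Q`. -/
def ReducesTo (Q : V → R) (P : X → R) : Prop :=
  ∃ f : V →ₗ[R] X, Function.Surjective f ∧ ∀ x, Q x = P (f x)

theorem ReducesTo.trans {Q : V → R} {P : X → R} {N : Y → R} (hQ : ReducesTo Q P)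
    (hP : ReducesTo P N) : ReducesTo Q N := by
  obtain ⟨f, hf, hQ⟩ := hQ
  obtain ⟨g, hg, hP⟩ := hP
  exact ⟨g ∘ₗ f, hg.comp hf, fun x => by rw [hQ, hP, LinearMap.comp_apply]⟩

theorem ReducesTo.of_linearEquiv (e : V ≃ₗ[R] X) {Q : V → R} {P : X → R}
    (h : ∀ x, Q x = P (e x)) : ReducesTo Q P :=
  ⟨e, e.surjective, h⟩

theorem ReducesTo.prod_right (Q : QuadraticForm R V) {P : QuadraticForm R W}
    {N : QuadraticForm R X} (h : ReducesTo P N) : ReducesTo (Q.prod P) (Q.prod N) := by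
  obtain ⟨f, hf, h⟩ := h
  exact ⟨LinearMap.id.prodMap f, Function.surjective_id.prodMap hf, fun x => by simp [h]⟩

theorem ReducesTo.of_prod_of_forall_eq_zero {P : QuadraticForm R V} {N : QuadraticForm R X}
    (hN : ∀ x, N x = 0) : ReducesTo (P.prod N) P :=
  ⟨LinearMap.fst R V X, Prod.fst_surjective, fun x => by simp [hN]⟩

theorem radical_prod_eq_bot {Q : QuadraticForm R V} {P : QuadraticForm R W}
    (hQ : Q.polarBilin.ker = ⊥) (hP : P.radical = ⊥) : (Q.prod P).radical = ⊥ := by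
  refine (Submodule.eq_bot_iff _).2 fun ⟨x, y⟩ ⟨h0, h⟩ => ?_
  have hx : x = 0 := LinearMap.ker_eq_bot'.1 hQ x <| LinearMap.ext fun v => by
    simpa using LinearMap.congr_fun h (v, 0)
  have hy : y ∈ P.radical := ⟨by simpa [hx] using h0, LinearMap.ext fun w => by
    simpa using LinearMap.congr_fun h (0, w)⟩
  rw [hP, Submodule.mem_bot] at hy
  exact Prod.ext hx hy

theorem radical_eq_bot_of_anisotropic {Q : QuadraticForm R V} (hQ : Q.Anisotropic) :
    Q.radical = ⊥ :=
  (Submodule.eq_bot_iff _).2 fun _ hx => hQ _ hx.1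

theorem ker_polarBilin_prod {Q : QuadraticForm R V} {P : QuadraticForm R W}
    (hQ : Q.polarBilin.ker = ⊥) (hP : P.polarBilin.ker = ⊥) : (Q.prod P).polarBilin.ker = ⊥ := by
  refine LinearMap.ker_eq_bot'.2 fun x hx => Prod.ext ?_ ?_
  · exact LinearMap.ker_eq_bot'.1 hQ x.1 <| LinearMap.ext fun v => by
      simpa using LinearMap.congr_fun hx (v, 0)
  · exact LinearMap.ker_eq_bot'.1 hP x.2 <| LinearMap.ext fun w => by
      simpa using LinearMap.congr_fun hx (0, w)

end Reduction

section Hyperbolic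

open Module QuadraticMap

variable (R : Type*) [CommRing R]

/-- The hyperbolic plane `u v`. -/
def hyperbolicPlane : QuadraticForm R (R × R) :=
  linMulLin (LinearMap.fst R R R) (LinearMap.snd R R R)

@[simp]
theorem hyperbolicPlane_apply (x : R × R) : hyperbolicPlane R x = x.1 * x.2 := rfl

/-- The orthogonal sum `u₁ v₁ + ⋯ + uₖ vₖ` of `k` hyperbolic planes. -/
def hyperbolicForm (k : ℕ) : QuadraticForm R (Fin k → R × R) :=
  QuadraticMap.pi fun _ => hyperbolicPlane R

@[simp]
theorem hyperbolicForm_apply (k : ℕ) (x : Fin k → R × R) :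
    hyperbolicForm R k x = ∑ j, (x j).1 * (x j).2 := by
  simp [hyperbolicForm]

theorem ker_polarBilin_hyperbolicPlane : (hyperbolicPlane R).polarBilin.ker = ⊥ := by
  refine LinearMap.ker_eq_bot'.2 fun x hx => Prod.ext ?_ ?_
  · simpa [polar, mul_add] using LinearMap.congr_fun hx (0, 1)
  · simpa [polar, add_mul] using LinearMap.congr_fun hx (1, 0)

theorem ker_polarBilin_hyperbolicForm (k : ℕ) : (hyperbolicForm R k).polarBilin.ker = ⊥ := by
  classical
  refine LinearMap.ker_eq_bot'.2 fun x hx => funext fun j =>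
    LinearMap.ker_eq_bot'.1 (ker_polarBilin_hyperbolicPlane R) _ <| LinearMap.ext fun y => ?_
  have := LinearMap.congr_fun hx (Pi.single j y)
  rw [polarBilin_apply_apply, hyperbolicForm, Ring.polar_pi, Finset.sum_eq_single j] at this
  · simpa using this
  · intro i _ hi
    simp [hi]
  · simp

theorem hyperbolicForm_succ (k : ℕ) (x : (R × R) × (Fin k → R × R)) :
    hyperbolicForm R (k + 1) (Fin.consLinearEquiv R (fun _ => R × R) x) =
      (hyperbolicPlane R).prod (hyperbolicForm R k) x := by
  simp [Fin.sum_univ_succ, Fin.consLinearEquiv]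

end Hyperbolic

section Types

open Module QuadraticMap

variable {K V ι κ : Type*} [Field K] [AddCommGroup V] [Module K V]

theorem linearIndependent_dual_iff [Finite ι] (φ : ι → Dual K V) :
    LinearIndependent K φ ↔ ∀ c : ι → K, ∃ x, ∀ i, φ i x = c i := by
  classical
  have := Fintype.ofFinite ι
  have hcomb : Fintype.linearCombination K φ =
      (LinearMap.pi φ).dualMap ∘ₗ (Pi.basisFun K ι).toDualEquiv := by
    ext i x
    simpa using ((Pi.basisFun K ι).toDual_apply_right i (LinearMap.pi φ x)).symm
  have hsurj : (∀ c : ι → K, ∃ x, ∀ i, φ i x = c i) ↔ Function.Surjective (LinearMap.pi φ) := by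
    simp [Function.Surjective, funext_iff]
  rw [hsurj, linearIndependent_iff_injective_fintypeLinearCombination, hcomb, LinearMap.coe_comp,
    ← LinearMap.dualMap_injective_iff]
  exact Function.Injective.of_comp_iff' _ (Pi.basisFun K ι).toDualEquiv.bijective

variable {F : Type*} [Field F] [Algebra K F]

theorem isTypeOne_iff {Q : F → K} : IsTypeOne K Q ↔ ∃ k, ReducesTo Q (hyperbolicForm K k) := by
  constructor
  · rintro ⟨k, u, v, huv, hQ⟩
    rw [linearIndependent_dual_iff] at huv
    refine ⟨k, LinearMap.pi fun j => (u j).prod (v j), fun y => ?_, fun x => by simp [hQ]⟩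
    obtain ⟨x, hx⟩ := huv (Sum.elim (fun j => (y j).1) fun j => (y j).2)
    exact ⟨x, funext fun j => Prod.ext (hx (.inl j)) (hx (.inr j))⟩
  · rintro ⟨k, f, hf, hQ⟩
    refine ⟨k, fun j => .fst K K K ∘ₗ .proj j ∘ₗ f, fun j => .snd K K K ∘ₗ .proj j ∘ₗ f,
      (linearIndependent_dual_iff _).2 fun c => ?_, fun x => by simp [hQ]⟩
    obtain ⟨x, hx⟩ := hf fun j => (c (.inl j), c (.inr j))
    exact ⟨x, by rintro (j | j) <;> simp [hx]⟩

/-- The binary quadratic form `y² + a y z + b z²`. -/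
def binaryForm (a b : K) : QuadraticForm K (K × K) :=
  linMulLin (.fst K K K) (.fst K K K) + a • hyperbolicPlane K +
    b • linMulLin (.snd K K K) (.snd K K K)

@[simp]
theorem binaryForm_apply (a b : K) (x : K × K) :
    binaryForm a b x = x.1 ^ 2 + a * x.1 * x.2 + b * x.2 ^ 2 := by
  simp [binaryForm]
  ring

theorem isTypeThree_iff {Q : F → K} : IsTypeThree K Q ↔ ∃ k a b,
    (binaryForm a b).Anisotropic ∧ ReducesTo Q ((hyperbolicForm K k).prod (binaryForm a b)) := by
  constructor
  · rintro ⟨k, u, v, e, a, b, huve, hab, hQ⟩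
    rw [linearIndependent_dual_iff] at huve
    refine ⟨k, a, b, fun x hx => Prod.ext_iff.2 (hab _ _ (by simpa using hx)),
      (LinearMap.pi fun j => (u j).prod (v j)).prod ((e 0).prod (e 1)), fun y => ?_,
      fun x => by simp [hQ]⟩
    obtain ⟨x, hx⟩ := huve (Sum.elim (Sum.elim (fun j => (y.1 j).1) fun j => (y.1 j).2)
      ![y.2.1, y.2.2])
    exact ⟨x, Prod.ext (funext fun j => Prod.ext (hx (.inl (.inl j))) (hx (.inl (.inr j))))
      (Prod.ext (hx (.inr 0)) (hx (.inr 1)))⟩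
  · rintro ⟨k, a, b, hab, f, hf, hQ⟩
    refine ⟨k, fun j => .fst K K K ∘ₗ .proj j ∘ₗ .fst K _ _ ∘ₗ f,
      fun j => .snd K K K ∘ₗ .proj j ∘ₗ .fst K _ _ ∘ₗ f,
      ![.fst K K K ∘ₗ .snd K _ _ ∘ₗ f, .snd K K K ∘ₗ .snd K _ _ ∘ₗ f], a, b,
      (linearIndependent_dual_iff _).2 fun c => ?_,
      fun y z hyz => Prod.ext_iff.1 (hab (y, z) (by simpa using hyz)), fun x => by simp [hQ]⟩
    obtain ⟨x, hx⟩ := hf (fun j => (c (.inl (.inl j)), c (.inl (.inr j))), c (.inr 0), c (.inr 1))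
    exact ⟨x, by rintro ((j | j) | j) <;> [skip; skip; fin_cases j] <;> simp [hx]⟩

theorem ReducesTo.qfRank_eq {X : Type*} [AddCommGroup X] [Module K X] [FiniteDimensional K X]
    [FiniteDimensional K F] {Q : F → K} {P : QuadraticForm K X} (h : ReducesTo Q P)
    (hP : P.radical = ⊥) : qfRank K Q = finrank K X := by
  obtain ⟨f, hf, hQ⟩ := h
  let e : X ≃ₗ[K] (Fin (finrank K X) → K) := (finBasis K X).equivFun
  have hmem : finrank K X ∈ {r | ∃ (f : F →ₗ[K] (Fin r → K)) (P : QuadraticForm K (Fin r → K)),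
      ∀ x, Q x = P (f x)} :=
    ⟨e.toLinearMap ∘ₗ f, P.comp e.symm.toLinearMap, fun x => by simp [hQ]⟩
  refine le_antisymm (Nat.sInf_le hmem) (le_csInf ⟨_, hmem⟩ ?_)
  rintro r ⟨g, N, hg⟩
  have hker : LinearMap.ker g ≤ LinearMap.ker f := fun x hx => by
    have hrad : f x ∈ P.radical := mem_radical_iff'.2
      ⟨by rw [← hQ, hg, hx, map_zero], hf.forall.2 fun y => by
        rw [← map_add, ← hQ, ← hQ, hg, hg, map_add, hx, zero_add]⟩
    rwa [hP] at hrad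
  have hfker := LinearMap.finrank_range_add_finrank_ker f
  have hgker := LinearMap.finrank_range_add_finrank_ker g
  have hgrange := LinearMap.range g |>.finrank_le
  rw [LinearMap.range_eq_top.2 hf, finrank_top] at hfker
  rw [finrank_fin_fun] at hgrange
  have := Submodule.finrank_mono hker
  omega

end Types

section WittDecomposition

open Module QuadraticMap

variable {K V : Type*} [Field K] [AddCommGroup V] [Module K V]

theorem exists_hyperbolic_partner (Q : QuadraticForm K V) {x y : V} (hx : Q x = 0)
    (hxy : polar Q x y ≠ 0) : ∃ y', Q y' = 0 ∧ polar Q x y' = 1 := by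
  set c := (polar Q x y)⁻¹ with hc
  refine ⟨c • y + (-(c * c * Q y)) • x, ?_, ?_⟩
  · rw [QuadraticMap.map_add Q, QuadraticMap.map_smul, QuadraticMap.map_smul, polar_smul_right,
      polar_smul_left, polar_comm Q y x, hx]
    simp only [smul_eq_mul]
    linear_combination (-(c * c * Q y)) * inv_mul_cancel₀ hxy
  · simp [polar_add_right, polar_smul_right, hx, hc, hxy]

theorem exists_reducesTo_of_mem_radical [FiniteDimensional K V] {Q : QuadraticForm K V} {x : V}
    (hx : x ∈ Q.radical) (hx0 : x ≠ 0) : ∃ (W : Submodule K V) (P : QuadraticForm K (V ⧸ W)),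
      finrank K (V ⧸ W) < finrank K V ∧ ReducesTo Q P := by
  have hspan : K ∙ x ≤ Q.radical := by simpa using hx
  refine ⟨K ∙ x, Q.lift _ hspan, ?_, Submodule.mkQ _, Submodule.mkQ_surjective _, fun _ => rfl⟩
  have := Submodule.finrank_quotient_add_finrank (K ∙ x)
  rw [finrank_span_singleton hx0] at this
  omega

theorem exists_reducesTo_hyperbolicPlane_prod [FiniteDimensional K V] {Q : QuadraticForm K V}
    {x y : V} (hx : Q x = 0) (hy : Q y = 0) (hxy : polar Q x y = 1) :
    ∃ W : Submodule K V, finrank K W < finrank K V ∧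
      ReducesTo Q ((hyperbolicPlane K).prod (Q.comp W.subtype)) := by
  -- `x, y` span the plane, with dual coordinates `polar Q · y, polar Q · x`; `W` is the common
  -- kernel of the coordinates.
  let coord : V →ₗ[K] K × K := (Q.polarBilin.flip y).prod (Q.polarBilin.flip x)
  have hcoord z : coord z = (polar Q z y, polar Q z x) := rfl
  let comb : K × K →ₗ[K] V := (LinearMap.toSpanSingleton K V x).coprod (.toSpanSingleton K V y)
  have hcomb c : comb c = c.1 • x + c.2 • y := rfl
  have hcoord_comb c : coord (comb c) = c := by
    simp [hcoord, hcomb, polar_add_left, polar_smul_left, hx, hy, hxy, polar_comm Q y x]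
  have hQ (c : K × K) (w : V) (hw : coord w = 0) : Q (comb c + w) = c.1 * c.2 + Q w := by
    obtain ⟨hwy, hwx⟩ := Prod.ext_iff.1 ((hcoord w).symm.trans hw)
    dsimp only [Prod.fst_zero, Prod.snd_zero] at hwy hwx
    rw [QuadraticMap.map_add Q, hcomb, QuadraticMap.map_add Q, polar_add_left]
    simp only [QuadraticMap.map_smul, polar_smul_left, polar_smul_right, hx, hy, hxy,
      polar_comm Q _ w, hwy, hwx, smul_eq_mul]
    ring
  have hproj z : coord (z - comb (coord z)) = 0 := by rw [map_sub, hcoord_comb, sub_self]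
  refine ⟨LinearMap.ker coord, Submodule.finrank_lt ?_,
    coord.prod ((LinearMap.id - comb ∘ₗ coord).codRestrict _ hproj), ?_, fun z => ?_⟩
  · intro htop
    simpa [LinearMap.ker_eq_top.1 htop, Prod.ext_iff] using hcoord_comb (1, 0)
  · rintro ⟨c, w, hw⟩
    refine ⟨comb c + w, Prod.ext ?_ (Subtype.ext ?_)⟩
    · simp [hcoord_comb, LinearMap.mem_ker.1 hw]
    · change comb c + w - comb (coord (comb c + w)) = w
      simp [hcoord_comb, LinearMap.mem_ker.1 hw]
  · change Q z = _ + Q (z - comb (coord z))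
    simpa using hQ (coord z) _ (hproj z)

theorem ReducesTo.hyperbolicForm_succ_prod {W X : Type*} [AddCommGroup W] [Module K W]
    [AddCommGroup X] [Module K X] {Q : QuadraticForm K V} {P : QuadraticForm K W}
    {N : QuadraticForm K X} {k : ℕ} (hQ : ReducesTo Q ((hyperbolicPlane K).prod P))
    (hP : ReducesTo P ((hyperbolicForm K k).prod N)) :
    ReducesTo Q ((hyperbolicForm K (k + 1)).prod N) :=
  (hQ.trans (hP.prod_right _)).trans <| ReducesTo.of_linearEquiv
    ((LinearEquiv.prodAssoc K _ _ _).symm.trans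
      ((Fin.consLinearEquiv K fun _ => K × K).prodCongr (.refl K X)))
    fun x => by
      rw [LinearEquiv.trans_apply, LinearEquiv.prodCongr_apply, prod_apply _ N,
        hyperbolicForm_succ]
      exact (add_assoc _ _ _).symm

theorem exists_wittDecomposition [FiniteDimensional K V] (Q : QuadraticForm K V) :
    ∃ (k t : ℕ) (N : QuadraticForm K (Fin t → K)),
      N.Anisotropic ∧ ReducesTo Q ((hyperbolicForm K k).prod N) := by
  induction hn : finrank K V using Nat.strong_induction_on generalizing V with | _ n ih
  subst hn
  by_cases haniso : Q.Anisotropic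
  · refine ⟨0, finrank K V, Q.comp (finBasis K V).equivFun.symm.toLinearMap, fun x hx => ?_,
      ReducesTo.of_linearEquiv ((finBasis K V).equivFun.trans (LinearEquiv.uniqueProd).symm)
        fun x => by simp⟩
    exact (LinearEquiv.map_eq_zero_iff _).1 (haniso _ hx)
  obtain ⟨x, hx0, hx⟩ := (not_anisotropic_iff_exists Q).1 haniso
  by_cases hrad : x ∈ Q.radical
  · obtain ⟨W, P, hlt, hP⟩ := exists_reducesTo_of_mem_radical hrad hx0
    obtain ⟨k, t, N, hN, hred⟩ := ih _ hlt P rfl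
    exact ⟨k, t, N, hN, hP.trans hred⟩
  · obtain ⟨z, hz⟩ : ∃ z, polar Q x z ≠ 0 := by
      by_contra! h
      exact hrad ⟨hx, LinearMap.ext h⟩
    obtain ⟨y, hy, hxy⟩ := exists_hyperbolic_partner Q hx hz
    obtain ⟨W, hlt, hW⟩ := exists_reducesTo_hyperbolicPlane_prod hx hy hxy
    obtain ⟨k, t, N, hN, hred⟩ := ih _ hlt (Q.comp W.subtype) rfl
    exact ⟨k + 1, t, N, hN, hW.hyperbolicForm_succ_prod hred⟩

end WittDecomposition

section FiniteField

open Module QuadraticMap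

variable {K V : Type*} [Field K] [AddCommGroup V] [Module K V]

theorem exists_mvPolynomial_eval_eq {ι : Type*} [Fintype ι] (Q : QuadraticForm K V) (b : ι → V) :
    ∃ p : MvPolynomial ι K, p.totalDegree ≤ 2 ∧
      ∀ x, MvPolynomial.eval x p = Q (∑ i, x i • b i) := by
  obtain ⟨B, rfl⟩ := LinearMap.BilinMap.toQuadraticMap_surjective Q
  refine ⟨∑ i, ∑ j, MvPolynomial.C (B (b i) (b j)) * (MvPolynomial.X i * MvPolynomial.X j),
    MvPolynomial.totalDegree_finsetSum_le fun i _ =>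
      MvPolynomial.totalDegree_finsetSum_le fun j _ => ?_, fun x => ?_⟩
  · refine (MvPolynomial.totalDegree_mul _ _).trans ?_
    have := MvPolynomial.totalDegree_mul (MvPolynomial.X i : MvPolynomial ι K) (MvPolynomial.X j)
    simp only [MvPolynomial.totalDegree_X, MvPolynomial.totalDegree_C] at this ⊢
    omega
  · simp only [map_sum, map_mul, MvPolynomial.eval_C, MvPolynomial.eval_X, map_smul,
      LinearMap.BilinMap.toQuadraticMap_apply, LinearMap.sum_apply, LinearMap.smul_apply,
      smul_eq_mul, Finset.mul_sum]
    rw [Finset.sum_comm]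
    exact Finset.sum_congr rfl fun i _ => Finset.sum_congr rfl fun j _ => by ring

variable [Finite K]

theorem finrank_le_two_of_anisotropic [FiniteDimensional K V] {Q : QuadraticForm K V}
    (hQ : Q.Anisotropic) : finrank K V ≤ 2 := by
  classical
  by_contra! h
  have := Fintype.ofFinite K
  let b := finBasis K V
  obtain ⟨p, hdeg, hp⟩ := exists_mvPolynomial_eval_eq Q b
  obtain ⟨c, hc⟩ := CharP.exists K
  have hdvd := char_dvd_card_solutions c (f := p) (by simpa using hdeg.trans_lt h)
  have hsol x : MvPolynomial.eval x p = 0 ↔ x = 0 := by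
    rw [hp, hQ.eq_zero_iff, ← b.equivFun_symm_apply, LinearEquiv.map_eq_zero_iff]
  have hone : Fintype.card {x : Fin (finrank K V) → K // MvPolynomial.eval x p = 0} = 1 := by
    simp [hsol]
  rw [hone, Nat.dvd_one] at hdvd
  exact CharP.char_ne_one K c hdvd

theorem exists_apply_eq_of_anisotropic {Q : QuadraticForm K V} (hQ : Q.Anisotropic)
    (hV : finrank K V = 2) (c : K) : ∃ x, Q x = c := by
  have := FiniteDimensional.of_finrank_eq_succ hV
  by_contra! h
  -- If `c` is not a value of `Q`, then `Q x - c t ^ 2` is anisotropic in three variables.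
  let N : QuadraticForm K (V × K) := Q.prod (-c • QuadraticMap.sq)
  have hN x t : N (x, t) = Q x - c * (t * t) := by simp [N, sub_eq_add_neg]
  have hN_aniso : N.Anisotropic := by
    rintro ⟨x, t⟩ hx
    rw [hN] at hx
    by_cases ht : t = 0
    · simpa [ht, hQ.eq_zero_iff] using hx
    · refine absurd ?_ (h (t⁻¹ • x))
      rw [QuadraticMap.map_smul, sub_eq_zero.1 hx, smul_eq_mul]
      field_simp
  have := finrank_le_two_of_anisotropic hN_aniso
  simp [hV] at this

theorem exists_equiv_binaryForm {Q : QuadraticForm K V} (hQ : Q.Anisotropic)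
    (hV : finrank K V = 2) :
    ∃ (a b : K) (e : V ≃ₗ[K] K × K), ∀ x, Q x = binaryForm a b (e x) := by
  obtain ⟨x, hx⟩ := exists_apply_eq_of_anisotropic hQ hV 1
  have hx0 : x ≠ 0 := by
    rintro rfl
    simp at hx
  obtain ⟨y, hxy⟩ : ∃ y, LinearIndependent K ![x, y] :=
    exists_linearIndependent_pair_of_one_lt_finrank (by omega) hx0
  let B := basisOfLinearIndependentOfCardEqFinrank hxy (by simp [hV])
  have hB : ⇑B = ![x, y] := coe_basisOfLinearIndependentOfCardEqFinrank _ _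
  refine ⟨polar Q x y, Q y, B.equivFun.trans (LinearEquiv.finTwoArrow K K), fun z => ?_⟩
  conv_lhs => rw [← B.sum_equivFun z, Fin.sum_univ_two, hB, QuadraticMap.map_add Q]
  simp only [Matrix.cons_val_zero, Matrix.cons_val_one, QuadraticMap.map_smul, polar_smul_left,
    polar_smul_right, hx, smul_eq_mul, LinearEquiv.trans_apply, LinearEquiv.finTwoArrow_apply,
    binaryForm_apply]
  ring

theorem ker_polarBilin_eq_bot_of_anisotropic {Q : QuadraticForm K V}
    (hQ : Q.Anisotropic) (hV : finrank K V = 2) : Q.polarBilin.ker = ⊥ := by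
  refine LinearMap.ker_eq_bot'.2 fun x hx => hQ x ?_
  have hpolar y : polar Q x y = 0 := LinearMap.congr_fun hx y
  have htwo : 2 * Q x = 0 := by simpa [polar_self] using hpolar x
  by_contra hQx
  have htwo : (2 : K) = 0 := (mul_eq_zero.1 htwo).resolve_right hQx
  have hx0 : x ≠ 0 := by
    rintro rfl
    simp at hQx
  obtain ⟨y, hxy⟩ : ∃ y, LinearIndependent K ![x, y] :=
    exists_linearIndependent_pair_of_one_lt_finrank (by omega) hx0
  have : CharP K 2 := CharTwo.of_one_ne_zero_of_two_eq_zero one_ne_zero htwo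
  -- `Q y / Q x = t ^ 2` is a square, so the anisotropic form `Q` vanishes at `t x - y`.
  obtain ⟨t, ht⟩ := FiniteField.isSquare_of_char_two (ringChar.eq K 2 ▸ rfl) (Q y / Q x)
  have hzero : Q (t • x + (-1 : K) • y) = 0 := by
    rw [QuadraticMap.map_add Q, QuadraticMap.map_smul, QuadraticMap.map_smul, polar_smul_left,
      polar_smul_right, hpolar, ← ht, smul_eq_mul, div_mul_cancel₀ _ hQx]
    simp only [smul_eq_mul]
    linear_combination Q y * htwo
  exact neg_ne_zero.2 one_ne_zero (LinearIndependent.pair_iff.1 hxy t (-1) (hQ _ hzero)).2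

theorem card_binaryForm_level_mul {a b : K} (hab : (binaryForm a b).Anisotropic)
    {c : K} (hc : c ≠ 0) (d : K) :
    Nat.card {x // binaryForm a b x = c * d} = Nat.card {x // binaryForm a b x = d} := by
  -- The form is the norm form of a quadratic extension of `K`, and the norm is multiplicative.
  let e : K × K ≃ QuadraticAlgebra K (-b) a := (QuadraticAlgebra.equivProd _ _).symm
  have hnorm x : (e x).norm = binaryForm a b x := by
    simp [e, QuadraticAlgebra.norm_def]
    ring
  obtain ⟨w, hw⟩ := exists_apply_eq_of_anisotropic hab (by simp) c
  obtain ⟨u, hu⟩ : IsUnit (e w) := by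
    rw [QuadraticAlgebra.isUnit_iff_norm_isUnit, hnorm, hw]
    exact hc.isUnit
  refine (Nat.card_congr <| ((e.trans u.mulLeft).trans e.symm).subtypeEquiv fun x => ?_).symm
  rw [← hnorm (((e.trans u.mulLeft).trans e.symm) x)]
  simp [hu, hnorm, hw, hc]

variable {F : Type*} [Field F] [Algebra K F]

theorem isTypeOne_or_isTypeThree_of_even [FiniteDimensional K F] (Q : QuadraticForm K F)
    (hQ : Even (qfRank K Q)) : IsTypeOne K Q ∨ IsTypeThree K Q := by
  obtain ⟨k, t, N, hN, hred⟩ := exists_wittDecomposition Q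
  have hrank : qfRank K Q = 2 * k + t := by
    rw [hred.qfRank_eq (radical_prod_eq_bot (ker_polarBilin_hyperbolicForm K k)
      (radical_eq_bot_of_anisotropic hN))]
    simp [finrank_pi_fintype, mul_comm]
  have ht : t ≤ 2 := by simpa using finrank_le_two_of_anisotropic hN
  obtain rfl | rfl : t = 0 ∨ t = 2 := by
    have := (Nat.even_add.1 (hrank ▸ hQ)).1 (even_two_mul k)
    grind
  · left
    exact isTypeOne_iff.2 ⟨k, hred.trans <| .of_prod_of_forall_eq_zero fun x => by
      rw [Subsingleton.elim x 0, map_zero]⟩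
  · right
    obtain ⟨a, b, e, he⟩ := exists_equiv_binaryForm hN (by simp)
    exact isTypeThree_iff.2 ⟨k, a, b,
      fun x hx => e.symm.map_eq_zero_iff.1 <| hN _ (by simp [he, hx]),
      hred.trans <| .prod_right _ <| .of_linearEquiv e he⟩

end FiniteField

section Sign

open Module QuadraticMap

universe u

variable {K : Type u} {V W : Type*} [Field K] [Fintype K] [AddCommGroup V] [Module K V]
  [AddCommGroup W] [Module K W]

theorem card_level_prod (Q : QuadraticForm K V) (P : QuadraticForm K W) (a : K) [Finite V]
    [Finite W] : Nat.card {x // Q.prod P x = a} =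
      ∑ b, Nat.card {x // Q x = b} * Nat.card {y // P y = a - b} := by
  let e : {x // Q.prod P x = a} ≃ Σ b, {x // Q x = b} × {y // P y = a - b} :=
    { toFun := fun x => ⟨Q x.1.1, ⟨x.1.1, rfl⟩, ⟨x.1.2, eq_sub_of_add_eq' x.2⟩⟩
      invFun := fun y => ⟨(y.2.1, y.2.2), by simp [y.2.1.2, y.2.2.2]⟩
      left_inv := fun _ => rfl
      right_inv := by rintro ⟨_, ⟨u, rfl⟩, v⟩; rfl }
  rw [Nat.card_congr e, Nat.card_sigma]
  simp only [Nat.card_prod]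

variable [DecidableEq K]

/-- The number of solutions of `P x = a` for a nondegenerate quadratic form `P` of dimension `2 h`
and sign `ε` over a field with `q` elements: `ε = 1` for hyperbolic forms, and `ε = -1` for the
others. -/
def levelCard (q : ℚ) (h : ℕ) (ε : ℚ) (a : K) : ℚ :=
  (q ^ (2 * h) - ε * q ^ h) / q + if a = 0 then ε * q ^ h else 0

/-- `P` is nondegenerate, of dimension `2 h`, and its values are distributed as those of a form of
sign `ε`. -/
structure HasSign (P : QuadraticForm K V) (h : ℕ) (ε : ℚ) : Prop where
  ker_polarBilin : P.polarBilin.ker = ⊥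
  finrank_eq : finrank K V = 2 * h
  card_level : ∀ a, (Nat.card {x // P x = a} : ℚ) = levelCard (Fintype.card K) h ε a

theorem sum_levelCard_mul_levelCard {q : ℚ} (hq : q = Fintype.card K) (h₁ h₂ : ℕ) (ε₁ ε₂ : ℚ)
    (a : K) : ∑ b, levelCard q h₁ ε₁ b * levelCard q h₂ ε₂ (a - b) =
      levelCard q (h₁ + h₂) (ε₁ * ε₂) a := by
  have hq0 : q ≠ 0 := by simp [hq]
  simp only [levelCard, mul_add, add_mul, Finset.sum_add_distrib, mul_ite, ite_mul, mul_zero,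
    zero_mul, sub_eq_zero, Finset.sum_ite_eq, Finset.sum_ite_eq', Finset.mem_univ, if_true,
    Finset.sum_const, Finset.card_univ, nsmul_eq_mul, ← hq]
  split_ifs <;> field_simp <;> ring

theorem HasSign.prod {Q : QuadraticForm K V} {P : QuadraticForm K W} {h₁ h₂ : ℕ} {ε₁ ε₂ : ℚ}
    [Finite V] [Finite W] (hQ : HasSign Q h₁ ε₁) (hP : HasSign P h₂ ε₂) :
    HasSign (Q.prod P) (h₁ + h₂) (ε₁ * ε₂) where
  ker_polarBilin := ker_polarBilin_prod hQ.ker_polarBilin hP.ker_polarBilin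
  finrank_eq := by
    have := Module.Finite.of_finite (R := K) (M := V)
    have := Module.Finite.of_finite (R := K) (M := W)
    rw [finrank_prod, hQ.finrank_eq, hP.finrank_eq, mul_add]
  card_level a := by
    rw [card_level_prod, ← sum_levelCard_mul_levelCard rfl]
    push_cast
    exact Finset.sum_congr rfl fun b _ => by rw [hQ.card_level, hP.card_level]

theorem hasSign_hyperbolicPlane : HasSign (hyperbolicPlane K) 1 1 where
  ker_polarBilin := ker_polarBilin_hyperbolicPlane K
  finrank_eq := by simp
  card_level a := by
    have hfiber (u : K) : Nat.card {v // u * v = a} =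
        if u = 0 then (if a = 0 then Fintype.card K else 0) else 1 := by
      split_ifs with hu ha
      · simp [hu, ha]
      · simp [hu, Ne.symm ha]
      · simp [← eq_inv_mul_iff_mul_eq₀ hu]
    have hq0 : (Fintype.card K : ℚ) ≠ 0 := by simp
    simp only [hyperbolicPlane_apply]
    rw [Nat.card_congr (Equiv.subtypeProdEquivSigmaSubtype fun u v => u * v = a), Nat.card_sigma]
    simp_rw [hfiber]
    rw [← Finset.add_sum_erase _ _ (Finset.mem_univ (0 : K)), if_pos rfl,
      Finset.sum_congr rfl fun u hu => if_neg (Finset.ne_of_mem_erase hu), Finset.sum_const,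
      Finset.card_erase_of_mem (Finset.mem_univ _), Finset.card_univ, smul_eq_mul, mul_one,
      Nat.cast_add, Nat.cast_sub Fintype.card_pos, levelCard]
    split_ifs <;> push_cast <;> field_simp <;> ring

theorem hasSign_hyperbolicForm (k : ℕ) : HasSign (hyperbolicForm K k) k 1 := by
  induction k with
  | zero =>
    refine ⟨ker_polarBilin_hyperbolicForm K 0, finrank_zero_of_subsingleton, fun a => ?_⟩
    by_cases ha : a = 0 <;> simp [levelCard, ha, Ne.symm]
  | succ k ih =>
    refine ⟨ker_polarBilin_hyperbolicForm K (k + 1), by simp [finrank_pi_fintype, mul_comm],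
      fun a => ?_⟩
    have hlevel := (hasSign_hyperbolicPlane.prod ih).card_level a
    rw [mul_one, add_comm 1 k] at hlevel
    rw [← hlevel, Nat.card_congr]
    exact ((Fin.consLinearEquiv K fun _ => K × K).toEquiv.subtypeEquiv fun x => by
      rw [← hyperbolicForm_succ]; rfl).symm

theorem hasSign_binaryForm {a b : K} (hab : (binaryForm a b).Anisotropic) :
    HasSign (binaryForm a b) 1 (-1) := by
  refine ⟨ker_polarBilin_eq_bot_of_anisotropic hab (by simp), by simp, ?_⟩
  have hzero : Nat.card {x // binaryForm a b x = 0} = 1 := by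
    simp [-binaryForm_apply, hab.eq_zero_iff]
  have hlevel (c : K) (hc : c ≠ 0) :
      Nat.card {x // binaryForm a b x = c} = Nat.card {x // binaryForm a b x = 1} := by
    simpa only [mul_one] using card_binaryForm_level_mul hab hc 1
  have hsum : ∑ c, Nat.card {x // binaryForm a b x = c} = Fintype.card K * Fintype.card K := by
    rw [← Nat.card_sigma, Nat.card_congr (Equiv.sigmaFiberEquiv _)]
    simp
  rw [← Finset.add_sum_erase _ _ (Finset.mem_univ 0), hzero,
    Finset.sum_congr rfl fun c hc => hlevel c (Finset.ne_of_mem_erase hc), Finset.sum_const,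
    Finset.card_erase_of_mem (Finset.mem_univ _), Finset.card_univ, smul_eq_mul] at hsum
  have hq : 1 < Fintype.card K := Fintype.one_lt_card
  have hone : Nat.card {x // binaryForm a b x = 1} = Fintype.card K + 1 := by
    zify [hq.le] at hsum ⊢
    refine mul_left_cancel₀ (a := (Fintype.card K : ℤ) - 1) (by omega) ?_
    linear_combination hsum
  intro c
  have hq0 : (Fintype.card K : ℚ) ≠ 0 := by simp
  rw [levelCard]
  split_ifs with hc
  · rw [hc, hzero]
    field_simp
    ring
  · rw [hlevel c hc, hone]
    push_cast
    field_simp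
    ring

variable {F : Type*} [Field F] [Algebra K F] {Q : F → K}

theorem HasTypeIndex.exists_hasSign {i : ℕ} (hQ : HasTypeIndex K Q i) :
    ∃ (h : ℕ) (X : Type u) (_ : AddCommGroup X) (_ : Module K X) (P : QuadraticForm K X),
      ReducesTo Q P ∧ HasSign P h ((-1) ^ (i + 1)) := by
  match i, hQ with
  | 1, hQ =>
    obtain ⟨k, hk⟩ := isTypeOne_iff.1 hQ
    exact ⟨k, _, _, _, _, hk, by simpa using hasSign_hyperbolicForm k⟩
  | 2, hQ =>
    obtain ⟨k, a, b, hab, hk⟩ := isTypeThree_iff.1 hQ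
    refine ⟨k + 1, _, _, _, _, hk, ?_⟩
    convert (hasSign_hyperbolicForm k).prod (hasSign_binaryForm hab) using 1
    norm_num

end Sign

section Counting

open Module QuadraticMap

variable {K V X : Type*} [Field K] [AddCommGroup V] [Module K V] [AddCommGroup X] [Module K X]

theorem card_mul_card_fiber_of_translate (G : V → K) (w : V)
    (hG : ∀ x (c : K), G (x + c • w) = G x + c) (d : K) :
    Nat.card K * Nat.card {x // G x = d} = Nat.card V := by
  rw [← Nat.card_prod]
  exact Nat.card_congr
    { toFun := fun p => p.2 + p.1 • w
      invFun := fun x => (G x - d, ⟨x - (G x - d) • w, by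
        rw [sub_eq_add_neg, ← neg_smul, hG]
        ring⟩)
      left_inv := by
        rintro ⟨c, x, hx⟩
        ext <;> simp [hG, hx]
      right_inv := fun x => by simp }

theorem card_mul_card_zeros_of_notMem_range_dualMap {f : V →ₗ[K] X} {φ : Dual K V}
    (hφ : φ ∉ f.dualMap.range) (P : X → K) (b : K) :
    Nat.card K * Nat.card {x // P (f x) + φ x + b = 0} = Nat.card V := by
  rw [LinearMap.range_dualMap_eq_dualAnnihilator_ker, Submodule.mem_dualAnnihilator] at hφ
  push Not at hφ
  obtain ⟨w, hw, hφw⟩ := hφ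
  refine card_mul_card_fiber_of_translate (fun x => P (f x) + φ x + b) ((φ w)⁻¹ • w) ?_ 0
  intro x c
  simp only [map_add, map_smul, LinearMap.mem_ker.1 hw, smul_zero, add_zero, smul_eq_mul,
    inv_mul_cancel₀ hφw]
  ring

theorem card_subtype_comp_of_surjective {f : V →ₗ[K] X} (hf : Function.Surjective f)
    (p : X → Prop) :
    Nat.card {x // p (f x)} = Nat.card f.ker * Nat.card {y // p y} := by
  obtain ⟨g, hg⟩ := f.exists_rightInverse_of_surjective (LinearMap.range_eq_top.2 hf)
  replace hg y : f (g y) = y := LinearMap.congr_fun hg y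
  rw [← Nat.card_prod]
  exact Nat.card_congr
    { toFun := fun x => (⟨x - g (f x), by simp [hg]⟩, ⟨f x, x.2⟩)
      invFun := fun z => ⟨z.1 + g z.2, by simpa [hg] using z.2.2⟩
      left_inv := fun x => by simp
      right_inv := fun z => by ext <;> simp [hg] }

theorem card_add_polar_add_eq_zero (P : QuadraticForm K X) (c : X) (b : K) :
    Nat.card {y // P y + polar P c y + b = 0} = Nat.card {y // P y = P c - b} := by
  refine Nat.card_congr ((Equiv.addRight c).subtypeEquiv fun y => ?_)
  rw [Equiv.coe_addRight, QuadraticMap.map_add P, polar_comm P y c]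
  grind

theorem bijective_polarBilin [FiniteDimensional K X] {P : QuadraticForm K X}
    (hP : P.polarBilin.ker = ⊥) : Function.Bijective P.polarBilin :=
  have hinj : Function.Injective P.polarBilin := LinearMap.ker_eq_bot.1 hP
  ⟨hinj, (LinearMap.injective_iff_surjective_of_finrank_eq_finrank
    Subspace.dual_finrank_eq.symm).1 hinj⟩

variable [Fintype K]

theorem natCast_card_eq_pow {q : ℚ} (hq : q = Fintype.card K) (V : Type*) [AddCommGroup V]
    [Module K V] [FiniteDimensional K V] : (Nat.card V : ℚ) = q ^ finrank K V := by
  rw [Module.natCard_eq_pow_finrank (K := K), Nat.card_eq_fintype_card, hq, Nat.cast_pow]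

variable [DecidableEq K]

theorem HasSign.card_zeros [Finite X] {P : QuadraticForm K X} {h : ℕ} {ε : ℚ} (hP : HasSign P h ε)
    {f : V →ₗ[K] X} (hf : Function.Surjective f) (c : X) (b : K) :
    (Nat.card {x // P (f x) + polar P c (f x) + b = 0} : ℚ) =
      Nat.card V / (Fintype.card K : ℚ) ^ (2 * h) * levelCard (Fintype.card K) h ε (P c - b) := by
  have hV : Nat.card V = Nat.card f.ker * Nat.card X := by
    simpa using card_subtype_comp_of_surjective hf fun _ => True
  have hX : (Nat.card X : ℚ) = (Fintype.card K : ℚ) ^ (2 * h) := by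
    rw [natCast_card_eq_pow (K := K) rfl, hP.finrank_eq]
  have hq : (Fintype.card K : ℚ) ^ (2 * h) ≠ 0 := by simp
  rw [card_subtype_comp_of_surjective hf fun y => P y + polar P c y + b = 0,
    card_add_polar_add_eq_zero, Nat.cast_mul, hP.card_level, hV, Nat.cast_mul, hX]
  field_simp

/-- The sum of `T n` over the numbers `n` of zeros of `Q + φ + b`, where `Q` is a form on a space
with `q ^ m` elements that reduces to a nondegenerate form `P` of dimension `2 h` and sign `ε`, and
`φ` runs over the linear forms that come from the space of `P`. -/
def levelSum (q : ℚ) (m h : ℕ) (ε : ℚ) (b : K) (T : ℚ → ℚ) : ℚ :=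
  levelCard q h ε b * T (q ^ m / q + ε * ((q - 1) * (q ^ m / q ^ h / q))) +
    (q ^ (2 * h) - levelCard q h ε b) * T (q ^ m / q - ε * (q ^ m / q ^ h / q))

theorem HasSign.sum_level [Fintype X] {P : QuadraticForm K X} {h : ℕ} {ε : ℚ} (hP : HasSign P h ε)
    {q : ℚ} (hq : q = Fintype.card K) (m : ℕ) (b : K) (T : ℚ → ℚ) :
    ∑ c : X, T (q ^ m / q ^ (2 * h) * levelCard q h ε (P c - b)) = levelSum q m h ε b T := by
  have hq0 : q ≠ 0 := by simp [hq]
  have hlevel : ((Finset.univ.filter fun c => P c = b).card : ℚ) = levelCard q h ε b := by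
    rw [hq, ← hP.card_level, Nat.card_eq_fintype_card, Fintype.card_subtype]
  have hval (c : X) : T (q ^ m / q ^ (2 * h) * levelCard q h ε (P c - b)) =
      if P c = b then T (q ^ m / q + ε * ((q - 1) * (q ^ m / q ^ h / q)))
      else T (q ^ m / q - ε * (q ^ m / q ^ h / q)) := by
    simp only [levelCard, sub_eq_zero]
    split_ifs <;> congr 1 <;> field_simp <;> ring
  have hcompl : ((Finset.univ.filter fun c => P c ≠ b).card : ℚ) =
      q ^ (2 * h) - levelCard q h ε b := by
    rw [eq_sub_iff_add_eq', ← hlevel, ← hP.finrank_eq, ← natCast_card_eq_pow hq,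
      Nat.card_eq_fintype_card, ← Nat.cast_add, Finset.card_filter_add_card_filter_not,
      Finset.card_univ]
  rw [Finset.sum_congr rfl fun c _ => hval c, Finset.sum_ite, Finset.sum_const, Finset.sum_const,
    nsmul_eq_mul, nsmul_eq_mul, hlevel, hcompl, levelSum]

theorem HasSign.sum_card_zeros [FiniteDimensional K V] [Fintype (Dual K V)] {Q : V → K}
    {P : QuadraticForm K X} {h : ℕ} {ε : ℚ} (hP : HasSign P h ε) (hQ : ReducesTo Q P)
    {q : ℚ} (hq : q = Fintype.card K) (b : K) (T : ℚ → ℚ) :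
    ∑ φ : Dual K V, T (Nat.card {x // Q x + φ x + b = 0}) =
      (q ^ finrank K V - q ^ (2 * h)) * T (q ^ finrank K V / q) +
        levelSum q (finrank K V) h ε b T := by
  classical
  obtain ⟨f, hf, hQ⟩ := hQ
  have : FiniteDimensional K X := .of_surjective f hf
  have := Module.finite_of_finite K (M := X)
  have := Fintype.ofFinite X
  have hq0 : q ≠ 0 := by simp [hq]
  have hbij := bijective_polarBilin hP.ker_polarBilin
  let Φ : X → Dual K V := fun c => f.dualMap (P.polarBilin c)
  have hΦ : Function.Injective Φ := (LinearMap.dualMap_injective_of_surjective hf).comp hbij.1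
  simp only [hQ]
  rw [← Finset.sum_compl_add_sum (Finset.univ.image Φ), Finset.sum_image hΦ.injOn,
    ← hP.sum_level hq]
  congr 1
  · have hcard φ (hφ : φ ∈ (Finset.univ.image Φ)ᶜ) :
        (Nat.card {x // P (f x) + φ x + b = 0} : ℚ) = q ^ finrank K V / q := by
      have hmem : φ ∉ f.dualMap.range := by
        rintro ⟨ψ, rfl⟩
        obtain ⟨c, rfl⟩ := hbij.2 ψ
        simp [Φ] at hφ
      rw [eq_div_iff hq0, ← natCast_card_eq_pow hq,
        ← card_mul_card_zeros_of_notMem_range_dualMap hmem P b, Nat.cast_mul, mul_comm, hq,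
        Nat.card_eq_fintype_card (α := K)]
    rw [Finset.sum_congr rfl fun φ hφ => by rw [hcard φ hφ], Finset.sum_const, nsmul_eq_mul,
      Finset.card_compl, Nat.cast_sub (Finset.card_le_univ _),
      Finset.card_image_of_injective _ hΦ, Finset.card_univ, ← Nat.card_eq_fintype_card,
      ← Nat.card_eq_fintype_card, natCast_card_eq_pow hq, natCast_card_eq_pow hq X,
      Subspace.dual_finrank_eq, hP.finrank_eq]
  · refine Finset.sum_congr rfl fun c _ => ?_
    rw [← natCast_card_eq_pow hq, hq, ← hP.card_zeros hf]
    rfl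

end Counting

section TraceDual

open Module QuadraticMap

variable {K F X : Type*} [Field K] [Fintype K] [DecidableEq K] [Field F] [Algebra K F]
  [AddCommGroup X] [Module K X] {Q : F → K} {P : QuadraticForm K X} {h : ℕ} {ε : ℚ}

theorem HasSign.qfRank_eq [Finite F] (hP : HasSign P h ε) (hQ : ReducesTo Q P) :
    qfRank K Q = 2 * h := by
  have : FiniteDimensional K F := Module.Finite.of_finite
  have : FiniteDimensional K X := hQ.elim fun f hf => .of_surjective f hf.1
  rw [hQ.qfRank_eq, hP.finrank_eq]
  exact eq_bot_iff.2 (P.radical_le_ker_polarBilin.trans_eq hP.ker_polarBilin)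

theorem HasSign.card_zeros_of_reducesTo [Finite F] (hP : HasSign P h ε) (hQ : ReducesTo Q P) :
    (Nat.card {x // Q x = 0} : ℚ) =
      Nat.card F / (Fintype.card K : ℚ) ^ (2 * h) * levelCard (Fintype.card K) h ε (0 : K) := by
  obtain ⟨f, hf, hQ⟩ := hQ
  have := Finite.of_surjective f hf
  simpa [hQ, polar] using hP.card_zeros hf 0 0

variable [Fintype F]

theorem HasSign.sum_card_zeros_trace (hP : HasSign P h ε) (hQ : ReducesTo Q P) {q : ℚ}
    (hq : q = Fintype.card K) (b : K) (T : ℚ → ℚ) :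
    ∑ β, T (Nat.card {x // Q x + Algebra.trace K F (β * x) + b = 0}) =
      (q ^ finrank K F - q ^ (2 * h)) * T (q ^ finrank K F / q) +
        levelSum q (finrank K F) h ε b T := by
  have : FiniteDimensional K F := Module.Finite.of_finite
  let e := (Algebra.traceForm K F).toDual (traceForm_nondegenerate K F)
  have : Fintype (Dual K F) := Fintype.ofEquiv F e.toEquiv
  rw [← hP.sum_card_zeros hQ hq, ← e.toEquiv.sum_comp]
  rfl

theorem HasTypeIndex.sum_card_zeros {i : ℕ} (hQ : HasTypeIndex K Q i) {q : ℚ}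
    (hq : q = Fintype.card K) (b : K) (T : ℚ → ℚ) :
    ∑ β, T (Nat.card {x // Q x + Algebra.trace K F (β * x) + b = 0}) =
      (q ^ finrank K F - q ^ qfRank K Q) * T (q ^ finrank K F / q) +
        levelSum q (finrank K F) (qfRank K Q / 2) ((-1) ^ (i + 1)) b T := by
  obtain ⟨h, _, _, _, _, hQP, hP⟩ := hQ.exists_hasSign
  rw [hP.sum_card_zeros_trace hQP hq, hP.qfRank_eq hQP, Nat.mul_div_cancel_left h two_pos]

end TraceDual

theorem not_isTypeThree_of_isTypeOne {K F : Type*} [Field K] [Finite K] [Field F] [Finite F]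
    [Algebra K F] {Q : F → K} (h₁ : IsTypeOne K Q) : ¬ IsTypeThree K Q := fun h₃ => by
  classical
  have := Fintype.ofFinite K
  have := Fintype.ofFinite F
  obtain ⟨h, _, _, _, P, hQP, hP⟩ := HasTypeIndex.exists_hasSign (i := 1) h₁
  obtain ⟨h', _, _, _, P', hQP', hP'⟩ := HasTypeIndex.exists_hasSign (i := 2) h₃
  have hq : (1 : ℚ) < Fintype.card K := mod_cast Fintype.one_lt_card
  have : (Nat.card F : ℚ) ≠ 0 := by simp
  obtain rfl : h = h' := by
    have := hP.qfRank_eq hQP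
    have := hP'.qfRank_eq hQP'
    omega
  have hzeros := hP'.card_zeros_of_reducesTo hQP'
  rw [hP.card_zeros_of_reducesTo hQP, levelCard, levelCard] at hzeros
  norm_num at hzeros
  field_simp at hzeros
  have hpos := mul_pos (pow_pos (one_pos.trans hq) h) (sub_pos.2 hq)
  linarith

section LinearizedPolynomials

open Module QuadraticMap

variable {K F : Type*} [Field K] [Fintype K] [Field F] {s : ℕ} {ℓ : Fin s → ℕ}

theorem mem_linearizedSpan_iff {R : F[X]} : R ∈ linearizedSpan K F ℓ ↔
    ∃ a : Fin s → F, R = ∑ i, a i • X ^ Fintype.card K ^ ℓ i := by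
  rw [linearizedSpan, ← Fintype.range_linearCombination]
  simp only [LinearMap.mem_range, Fintype.linearCombination_apply, eq_comm]

theorem linearIndependent_X_pow_card_pow (hℓ : Function.Injective ℓ) :
    LinearIndependent F fun i => (X : F[X]) ^ Fintype.card K ^ ℓ i := by
  have hinj : Function.Injective fun i => Fintype.card K ^ ℓ i :=
    (Nat.pow_right_injective Fintype.one_lt_card).comp hℓ
  convert (Polynomial.basisMonomials F).linearIndependent.comp _ hinj with i
  simp [X_pow_eq_monomial]

theorem finrank_linearizedSpan (hℓ : Function.Injective ℓ) :
    finrank F (linearizedSpan K F ℓ) = s := by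
  rw [linearizedSpan, finrank_span_eq_card (linearIndependent_X_pow_card_pow hℓ), Fintype.card_fin]

theorem smul_comp_mem_linearizedSpan (c : F) {R : F[X]} (hR : R ∈ linearizedSpan K F ℓ) :
    c • R.comp (C c * X) ∈ linearizedSpan K F ℓ := by
  obtain ⟨a, rfl⟩ := mem_linearizedSpan_iff.1 hR
  refine Submodule.smul_mem _ c (mem_linearizedSpan_iff.2
    ⟨fun i => a i * c ^ Fintype.card K ^ ℓ i, ?_⟩)
  simp only [Polynomial.sum_comp, smul_comp, pow_comp, X_comp, ← smul_eq_C_mul, _root_.smul_pow,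
    smul_smul]

instance : FiniteDimensional F (linearizedSpan K F ℓ) :=
  FiniteDimensional.span_of_finite F (Set.finite_range _)

variable [Algebra K F]

theorem exists_linearMap_eq_eval {R : F[X]} (hR : R ∈ linearizedSpan K F ℓ) :
    ∃ g : F →ₗ[K] F, ∀ x, g x = R.eval x := by
  obtain ⟨a, rfl⟩ := mem_linearizedSpan_iff.1 hR
  refine ⟨∑ i, a i • (FiniteField.frobeniusAlgHom K F ^ ℓ i).toLinearMap, fun x => ?_⟩
  simp [eval_finsetSum, AlgHom.coe_pow, FiniteField.coe_frobeniusAlgHom, pow_iterate]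

theorem exists_quadraticForm_eq_traceForm {R : F[X]} (hR : R ∈ linearizedSpan K F ℓ) :
    ∃ Q : QuadraticForm K F, ⇑Q = traceForm K R := by
  obtain ⟨g, hg⟩ := exists_linearMap_eq_eval hR
  refine ⟨LinearMap.BilinMap.toQuadraticMap ((Algebra.traceForm K F).compRight g), ?_⟩
  ext x
  simp [traceForm, hg, Algebra.traceForm_apply]

theorem polar_traceForm {R : F[X]} (hR : R ∈ linearizedSpan K F ℓ) (x y : F) :
    polar (traceForm K R) x y =
      Algebra.trace K F (x * R.eval y) + Algebra.trace K F (y * R.eval x) := by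
  obtain ⟨g, hg⟩ := exists_linearMap_eq_eval hR
  simp only [polar, traceForm, ← hg, map_add, mul_add, add_mul]
  ring

variable [Finite F]

theorem linearIndependent_pow_card_pow {ι : Type*} {e : ι → ℕ} (he : Function.Injective e)
    (hlt : ∀ i, e i < finrank K F) :
    LinearIndependent F fun i (x : F) => x ^ Fintype.card K ^ e i := by
  have hfrob : Function.Injective fun i =>
      ((FiniteField.frobeniusAlgHom K F ^ e i : F →ₐ[K] F) : F →* F) := by
    intro i j hij
    have := (FiniteField.bijective_frobeniusAlgHom_pow K F).1
      (a₁ := ⟨e i, hlt i⟩) (a₂ := ⟨e j, hlt j⟩) (AlgHom.ext fun x => DFunLike.congr_fun hij x)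
    exact he (Fin.mk.inj this)
  simpa [Function.comp_def, AlgHom.coe_pow, FiniteField.coe_frobeniusAlgHom, pow_iterate] using!
    (linearIndependent_monoidHom F F).comp _ hfrob

theorem trace_pow_card_pow (x : F) (n : ℕ) :
    Algebra.trace K F (x ^ Fintype.card K ^ n) = Algebra.trace K F x := by
  have : FiniteDimensional K F := Module.Finite.of_finite
  rw [← Algebra.trace_eq_of_algEquiv (FiniteField.frobeniusAlgEquivOfAlgebraic K F ^ n) x,
    AlgEquiv.coe_pow, FiniteField.coe_frobeniusAlgEquivOfAlgebraic_iterate]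

theorem trace_mul_pow_card_pow {n : ℕ} (hn : n ≤ finrank K F) (x y : F) :
    Algebra.trace K F (x * y ^ Fintype.card K ^ n) =
      Algebra.trace K F (x ^ Fintype.card K ^ (finrank K F - n) * y) := by
  have := Fintype.ofFinite F
  rw [← trace_pow_card_pow _ (finrank K F - n), mul_pow, ← pow_mul, ← pow_add,
    Nat.add_sub_cancel' hn, ← Module.card_eq_pow_finrank, FiniteField.pow_card]

theorem eq_zero_of_polar_traceForm_eq_zero (hℓ : Function.Injective ℓ)
    (hℓ_pos : ∀ i, 1 ≤ ℓ i) (hℓ_lt : ∀ i, 2 * ℓ i < finrank K F) {R : F[X]}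
    (hR : R ∈ linearizedSpan K F ℓ) (hpolar : ∀ x y, polar (traceForm K R) x y = 0) : R = 0 := by
  have : FiniteDimensional K F := Module.Finite.of_finite
  simp only [polar_traceForm hR] at hpolar
  obtain ⟨a, rfl⟩ := mem_linearizedSpan_iff.1 hR
  set q := Fintype.card K
  set m := finrank K F
  have hℓ_le i : ℓ i ≤ m := by have := hℓ_lt i; lia
  -- Moving the Frobenius maps to the other side of the trace form, the polar form is the trace form
  -- of `y` and the following linearized polynomial in `x`.
  have hadjoint (x : F) : ∑ i, a i * x ^ q ^ ℓ i +
      ∑ i, a i ^ q ^ (m - ℓ i) * x ^ q ^ (m - ℓ i) = 0 := by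
    refine (traceForm_nondegenerate K F).1 _ fun y => ?_
    have htrace : Algebra.trace K F (x * ∑ i, a i * y ^ q ^ ℓ i) =
        Algebra.trace K F ((∑ i, a i ^ q ^ (m - ℓ i) * x ^ q ^ (m - ℓ i)) * y) := by
      rw [Finset.mul_sum, Finset.sum_mul, map_sum, map_sum]
      refine Finset.sum_congr rfl fun i _ => ?_
      rw [← mul_assoc, trace_mul_pow_card_pow (hℓ_le i), mul_pow, mul_comm (x ^ _)]
    rw [← hpolar x y, Algebra.traceForm_apply, add_mul, map_add, ← htrace, add_comm, mul_comm _ y]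
    simp [eval_finsetSum, q]
  have hinj : Function.Injective (Sum.elim ℓ fun i => m - ℓ i) := by
    refine hℓ.sumElim (fun i j hij => hℓ ?_) fun i j => ?_
    all_goals have := hℓ_lt i; have := hℓ_lt j; grind
  have hindep := linearIndependent_pow_card_pow (K := K) (F := F) hinj (by
    rintro (i | i) <;> have := hℓ_lt i <;> have := hℓ_pos i <;> grind)
  have ha := Fintype.linearIndependent_iff.1 hindep (Sum.elim a fun i => a i ^ q ^ (m - ℓ i))
    (funext fun x => by simpa using hadjoint x)
  exact Finset.sum_eq_zero fun i _ => by rw [show a i = 0 from ha (Sum.inl i), zero_smul]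

end LinearizedPolynomials

section Codes

open Module QuadraticMap

theorem hammingNorm_units_add_card_zeros {K F : Type*} [Field K] [DecidableEq K] [Field F]
    [Fintype F] [DecidableEq F] (G : F → K) :
    hammingNorm (fun u : Fˣ => G u) + (if G 0 = 0 then 0 else 1) + Nat.card {x // G x = 0} =
      Fintype.card F := by
  have hunits : hammingNorm (fun u : Fˣ => G u) =
      ∑ x : {x : F // x ≠ 0}, if G x = 0 then 0 else 1 := by
    rw [hammingNorm, Finset.card_filter, ← unitsEquivNeZero.sum_comp]
    simp
  rw [hunits, add_comm (Finset.sum _ _),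
    ← Fintype.sum_eq_add_sum_subtype_ne (fun x => if G x = 0 then 0 else 1) 0,
    Nat.card_eq_fintype_card, Fintype.card_subtype, Finset.card_filter, ← Finset.sum_add_distrib,
    Fintype.card_eq_sum_ones]
  exact Finset.sum_congr rfl fun x _ => by split_ifs <;> rfl

variable {K F : Type*} [Field K] [Field F] [Algebra K F] (L : Submodule F F[X])

/-- The parametrization `((R, β), b) ↦ c_{R,b}(β)` of `C_{L,2}`. -/
noncomputable def codewordMap (K : Type*) {F : Type*} [Field K] [Field F] [Algebra K F]
    (L : Submodule F F[X]) : (L × F) × K →ₗ[K] (Fˣ → K) where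
  toFun p := codeword K p.1.1 p.1.2 p.2
  map_add' p p' := codeword_add K _ _ _ _ _ _
  map_smul' a p := by
    simpa [Algebra.smul_def, algebraMap_smul] using codeword_smul K a (p.1.1 : F[X]) p.1.2 p.2

theorem range_codewordMap : (codewordMap K L).range = codeTwo K L := by
  ext c
  constructor
  · rintro ⟨⟨⟨R, β⟩, b⟩, rfl⟩
    exact ⟨R, R.2, β, b, rfl⟩
  · rintro ⟨R, hR, β, b, rfl⟩
    exact ⟨((⟨R, hR⟩, β), b), rfl⟩

theorem range_codewordMap_comp_inl :
    (codewordMap K L ∘ₗ LinearMap.inl K (L × F) K).range = codeOne K L := by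
  ext c
  constructor
  · rintro ⟨⟨R, β⟩, rfl⟩
    exact ⟨R, R.2, β, rfl⟩
  · rintro ⟨R, hR, β, rfl⟩
    exact ⟨(⟨R, hR⟩, β), rfl⟩

variable {L}

theorem codeword_inv_mul (α : Fˣ) (R : F[X]) (β : F) (b : K) :
    (fun x => codeword K R β b (α⁻¹ * x)) =
      codeword K ((α⁻¹ : F) • R.comp (C (α⁻¹ : F) * X)) (β * (α⁻¹ : F)) b := by
  ext x
  simp only [codeword, Units.val_mul, Units.val_inv_eq_inv_val, eval_smul, eval_comp, eval_mul,
    eval_C, eval_X, smul_eq_mul]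
  ring_nf

theorem isCyclicCode_codeOne (hL : ∀ (c : F), ∀ R ∈ L, c • R.comp (C c * X) ∈ L) :
    IsCyclicCode (codeOne K L) := by
  rintro α - _ ⟨R, hR, β, rfl⟩
  exact ⟨_, hL _ R hR, _, codeword_inv_mul α R β 0⟩

theorem isCyclicCode_codeTwo (hL : ∀ (c : F), ∀ R ∈ L, c • R.comp (C c * X) ∈ L) :
    IsCyclicCode (codeTwo K L) := by
  rintro α - _ ⟨R, hR, β, b, rfl⟩
  exact ⟨_, hL _ R hR, _, b, codeword_inv_mul α R β b⟩

theorem codeword_apply (R : F[X]) (β : F) (b : K) (x : Fˣ) :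
    codeword K R β b x = traceForm K R x + Algebra.trace K F (β * x) + b := by
  simp [codeword, traceForm]

theorem hammingNorm_codeword [DecidableEq K] [Fintype F] [DecidableEq F] (R : F[X]) (β : F)
    (b : K) : (hammingNorm (codeword K R β b) : ℚ) = Fintype.card F - (if b = 0 then 0 else 1) -
      Nat.card {x // traceForm K R x + Algebra.trace K F (β * x) + b = 0} := by
  have hword : codeword K R β b = fun u : Fˣ => traceForm K R u + Algebra.trace K F (β * u) + b :=
    funext (codeword_apply R β b)
  have hcard := hammingNorm_units_add_card_zeros
    fun x : F => traceForm K R x + Algebra.trace K F (β * x) + b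
  have hzero : traceForm K R 0 + Algebra.trace K F (β * 0) + b = b := by simp [traceForm]
  simp only [hzero] at hcard
  rw [hword, ← hcard]
  push_cast
  ring

theorem exists_pairwise_add_ne_zero {V : Type*} [AddCommGroup V] [Finite V] (hV : 4 < Nat.card V) :
    ∃ x y z : V, x ≠ 0 ∧ y ≠ 0 ∧ z ≠ 0 ∧ x + y ≠ 0 ∧ y + z ≠ 0 ∧ z + x ≠ 0 ∧ x + y + z ≠ 0 := by
  classical
  have := Fintype.ofFinite V
  have havoid (S : Finset V) (hS : S.card ≤ 4) : ∃ x, x ∉ S := by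
    by_contra! hall
    have := Finset.card_eq_iff_eq_univ S |>.2 (Finset.eq_univ_iff_forall.2 hall)
    rw [Nat.card_eq_fintype_card] at hV
    omega
  obtain ⟨x, hx⟩ := havoid {0} (by simp)
  obtain ⟨y, hy⟩ := havoid {0, -x} (Finset.card_le_two.trans (by norm_num))
  obtain ⟨z, hz⟩ := havoid {0, -x, -y, -(x + y)} Finset.card_le_four
  simp only [Finset.mem_insert, Finset.mem_singleton, not_or] at hx hy hz
  exact ⟨x, y, z, hx, hy.1, hz.1, fun h => hy.2 (eq_neg_of_add_eq_zero_right h),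
    fun h => hz.2.2.1 (eq_neg_of_add_eq_zero_right h),
    fun h => hz.2.1 (eq_neg_of_add_eq_zero_left h),
    fun h => hz.2.2.2 (eq_neg_of_add_eq_zero_right h)⟩

theorem const_eq_zero_of_forall_ne_zero {V : Type*} [AddCommGroup V] [Module K V] [Finite V]
    (hV : 4 < Nat.card V) {Q : QuadraticForm K V} {φ : Dual K V} {b : K}
    (h : ∀ x ≠ 0, Q x + φ x + b = 0) : b = 0 := by
  obtain ⟨x, y, z, hx, hy, hz, hxy, hyz, hzx, hxyz⟩ := exists_pairwise_add_ne_zero hV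
  have hsum := h _ hxyz
  have hxy := h _ hxy
  have hyz := h _ hyz
  have hzx := h _ hzx
  simp only [map_add] at hsum hxy hyz hzx
  -- Inclusion-exclusion: third differences kill polynomial functions of degree two.
  linear_combination hsum - hxy - hyz - hzx + h x hx + h y hy + h z hz - Q.map_add_add_add_map x y z

theorem four_lt_natCard [Finite K] [Finite F] {s : ℕ} {ℓ : Fin s → ℕ}
    (hs : 1 ≤ s) (hℓ_pos : ∀ i, 1 ≤ ℓ i) (hℓ_lt : ∀ i, 2 * ℓ i < finrank K F) : 4 < Nat.card F := by
  have hm : 3 ≤ finrank K F := by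
    have := hℓ_pos ⟨0, hs⟩
    have := hℓ_lt ⟨0, hs⟩
    omega
  calc 4 < 2 ^ 3 := by norm_num
    _ ≤ Nat.card K ^ finrank K F :=
      (Nat.pow_le_pow_left Finite.one_lt_card 3).trans (Nat.pow_le_pow_right Nat.card_pos hm)
    _ = Nat.card F := (Module.natCard_eq_pow_finrank (K := K)).symm

section LinearizedSpan

variable [Fintype K] [Finite F] {s : ℕ} {ℓ : Fin s → ℕ}

theorem injective_codewordMap (hs : 1 ≤ s) (hℓ : Function.Injective ℓ)
    (hℓ_pos : ∀ i, 1 ≤ ℓ i) (hℓ_lt : ∀ i, 2 * ℓ i < finrank K F) :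
    Function.Injective (codewordMap K (linearizedSpan K F ℓ)) := by
  have : FiniteDimensional K F := Module.Finite.of_finite
  refine (injective_iff_map_eq_zero _).2 ?_
  rintro ⟨⟨⟨R, hR⟩, β⟩, b⟩ hword
  obtain ⟨Q, hQ⟩ := exists_quadraticForm_eq_traceForm hR
  let φ : Dual K F := Algebra.traceForm K F β
  have hunits (x : F) (hx : x ≠ 0) : Q x + φ x + b = 0 := by
    have hx0 : codeword K R β b (Units.mk0 x hx) = 0 := congrFun hword _
    rwa [codeword_apply, ← hQ] at hx0
  obtain rfl : b = 0 :=
    const_eq_zero_of_forall_ne_zero (four_lt_natCard hs hℓ_pos hℓ_lt) hunits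
  have hall (x : F) : Q x = -φ x := by
    rcases eq_or_ne x 0 with rfl | hx
    · simp
    · simpa [add_eq_zero_iff_eq_neg] using hunits x hx
  obtain rfl : R = 0 := eq_zero_of_polar_traceForm_eq_zero hℓ hℓ_pos hℓ_lt hR fun x y => by
    simp only [← hQ, polar, hall, map_add]
    ring
  have hβ : β = 0 := (traceForm_nondegenerate K F).1 β fun x => by
    simpa [hQ, traceForm, φ] using hall x
  simp [hβ]

theorem finrank_linearizedSpan_prod (hℓ : Function.Injective ℓ) :
    finrank K (linearizedSpan K F ℓ × F) = finrank K F * (s + 1) := by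
  have : FiniteDimensional K F := Module.Finite.of_finite
  have : FiniteDimensional K (linearizedSpan K F ℓ) :=
    Module.Finite.trans F _
  rw [finrank_prod, ← finrank_mul_finrank K F, finrank_linearizedSpan hℓ, mul_add, mul_one]

theorem finrank_codeOne (hs : 1 ≤ s) (hℓ : Function.Injective ℓ)
    (hℓ_pos : ∀ i, 1 ≤ ℓ i) (hℓ_lt : ∀ i, 2 * ℓ i < finrank K F) :
    finrank K (codeOne K (linearizedSpan K F ℓ)) = finrank K F * (s + 1) := by
  rw [← range_codewordMap_comp_inl, LinearMap.finrank_range_of_inj,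
    finrank_linearizedSpan_prod hℓ]
  exact (injective_codewordMap hs hℓ hℓ_pos hℓ_lt).comp LinearMap.inl_injective

theorem finrank_codeTwo (hs : 1 ≤ s) (hℓ : Function.Injective ℓ)
    (hℓ_pos : ∀ i, 1 ≤ ℓ i) (hℓ_lt : ∀ i, 2 * ℓ i < finrank K F) :
    finrank K (codeTwo K (linearizedSpan K F ℓ)) = finrank K F * (s + 1) + 1 := by
  have : FiniteDimensional K F := Module.Finite.of_finite
  have : FiniteDimensional K (linearizedSpan K F ℓ) :=
    Module.Finite.trans F _
  rw [← range_codewordMap, LinearMap.finrank_range_of_inj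
    (injective_codewordMap hs hℓ hℓ_pos hℓ_lt), finrank_prod, finrank_linearizedSpan_prod hℓ,
    finrank_self]

end LinearizedSpan

end Codes

section EvenRankFamily

open Module

theorem weightFreq_range {K M ι : Type*} [Field K] [DecidableEq K] [Fintype M] [AddCommGroup M]
    [Module K M] [Fintype ι] {f : M →ₗ[K] ι → K} (hf : Function.Injective f) (w : ℕ) :
    (weightFreq f.range w : ℚ) = ∑ x, tableRow (hammingNorm (f x)) 1 w := by
  have himage : {c | c ∈ f.range ∧ hammingNorm c = w} = f '' {x | w = hammingNorm (f x)} := by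
    ext c
    constructor
    · rintro ⟨⟨x, rfl⟩, hx⟩
      exact ⟨x, hx.symm, rfl⟩
    · rintro ⟨x, hx, rfl⟩
      exact ⟨⟨x, rfl⟩, hx.symm⟩
  simp only [weightFreq, himage, Set.ncard_image_of_injective _ hf, tableRow, Nat.cast_inj,
    Finset.sum_boole, ← Set.ncard_coe_finset, Finset.coe_filter_univ]

theorem finsum_mem_range_ncard_mul {ι κ : Type*} [Fintype ι] (ρ : ι → κ) (p : ι → Prop)
    [DecidablePred p] (g : κ → ℚ) :
    ∑ᶠ r ∈ Set.range ρ, ({x | p x ∧ ρ x = r}.ncard : ℚ) * g r = ∑ x with p x, g (ρ x) := by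
  classical
  have hrange : Set.range ρ = (Finset.univ.image ρ : Finset κ) := by simp
  rw [hrange, finsum_mem_coe_finset, ← Finset.sum_fiberwise_of_maps_to
    fun x _ => Finset.mem_image_of_mem ρ (Finset.mem_univ x)]
  refine Finset.sum_congr rfl fun r _ => ?_
  rw [Finset.sum_congr rfl fun x hx => by rw [(Finset.mem_filter.1 hx).2], Finset.sum_const,
    nsmul_eq_mul, Finset.filter_filter, ← Set.ncard_coe_finset, Finset.coe_filter_univ]

variable {K F : Type*} [Field K] [Field F] [Algebra K F] {L : Submodule F F[X]}

theorem rankSet_eq_range (L : Submodule F F[X]) :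
    rankSet K L = Set.range fun R : L => qfRank K (traceForm K (R : F[X])) := by
  ext r
  simp [rankSet]

theorem ncard_mem_and (L : Submodule F F[X]) (p : F[X] → Prop) :
    {R | R ∈ L ∧ p R}.ncard = {R : L | p R}.ncard := by
  rw [← Set.ncard_image_of_injective _ Subtype.val_injective]
  congr 1
  ext R
  simp [and_comm]

variable [Fintype L]

theorem finsum_rankCount_mul (g : ℕ → ℚ) :
    ∑ᶠ r ∈ rankSet K L, (rankCount K L r : ℚ) * g r =
      ∑ R : L, g (qfRank K (traceForm K (R : F[X]))) := by
  simpa [rankSet_eq_range, rankCount, ncard_mem_and] using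
    finsum_mem_range_ncard_mul (fun R : L => qfRank K (traceForm K (R : F[X]))) (fun _ => True) g

open Classical in
theorem finsum_rankTypeCount_mul (i : ℕ) (g : ℕ → ℚ) :
    ∑ᶠ r ∈ rankSet K L, (rankTypeCount K L r i : ℚ) * g r =
      ∑ R ∈ ({R | R ≠ 0 ∧ HasTypeIndex K (traceForm K (R : F[X])) i} : Finset L),
        g (qfRank K (traceForm K (R : F[X]))) := by
  rw [← finsum_mem_range_ncard_mul (fun R : L => qfRank K (traceForm K (R : F[X]))),
    ← rankSet_eq_range]
  refine finsum_mem_congr rfl fun r _ => ?_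
  rw [rankTypeCount, ncard_mem_and]
  congr 3
  ext R
  simp only [ne_eq, Submodule.coe_eq_zero, Set.mem_ofPred_eq]
  tauto

theorem hasTypeIndex_traceForm_zero : HasTypeIndex K (traceForm K (0 : F[X])) 1 :=
  ⟨0, Fin.elim0, Fin.elim0, linearIndependent_empty_type, fun x => by simp [traceForm]⟩

theorem qfRank_traceForm_zero : qfRank K (traceForm K (0 : F[X])) = 0 :=
  Nat.sInf_eq_zero.2 (Or.inl ⟨0, 0, fun x => by simp [traceForm]⟩)

theorem sum_eq_add_finsum_rankTypeCount [Finite K] [Finite F]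
    (hL : ∀ R ∈ L, IsTypeOne K (traceForm K R) ∨ IsTypeThree K (traceForm K R)) {A : F[X] → ℚ}
    {B : ℕ → ℕ → ℚ}
    (hA : ∀ R i, HasTypeIndex K (traceForm K R) i → A R = B (qfRank K (traceForm K R)) i) :
    ∑ R : L, A R = B 0 1 +
      ∑ᶠ r ∈ rankSet K L, ∑ i ∈ ({1, 2} : Finset ℕ), (rankTypeCount K L r i : ℚ) * B r i := by
  classical
  have hfin : (rankSet K L).Finite := by
    rw [rankSet_eq_range]
    exact Set.finite_range _
  have htype (i : ℕ) : ∑ᶠ r ∈ rankSet K L, (rankTypeCount K L r i : ℚ) * B r i =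
      ∑ R ∈ ({R | R ≠ 0 ∧ HasTypeIndex K (traceForm K (R : F[X])) i} : Finset L), A R := by
    rw [finsum_rankTypeCount_mul i fun r => B r i]
    exact Finset.sum_congr rfl fun R hR => (hA _ _ (Finset.mem_filter.1 hR).2.2).symm
  have hthree (R : L) : HasTypeIndex K (traceForm K (R : F[X])) 2 ↔
      ¬ HasTypeIndex K (traceForm K (R : F[X])) 1 :=
    ⟨fun h₃ h₁ => not_isTypeThree_of_isTypeOne h₁ h₃, (hL R R.2).resolve_left⟩
  have hzero : A (0 : L) = B 0 1 := by
    simpa [qfRank_traceForm_zero] using hA 0 1 hasTypeIndex_traceForm_zero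
  simp only [Finset.sum_pair (show (1 : ℕ) ≠ 2 by norm_num)]
  rw [finsum_mem_add_distrib hfin, htype, htype, ← Finset.filter_filter, ← Finset.filter_filter,
    Finset.filter_congr fun R _ => hthree R, Finset.sum_filter_add_sum_filter_not, ← hzero,
    Finset.filter_ne', Finset.add_sum_erase _ (fun R : L => A R) (Finset.mem_univ 0)]

/-- The sum of `T n` over the numbers `n` of zeros of the functions `Q_R + Tr(β ·) + b`, for a fixed
`b`, `β` running over a field with `q ^ m` elements and `R` over a space with the rank statistics
`Rset`, `M`, `Mi` of `tableOne`. -/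
noncomputable def familySum {K : Type*} [Field K] [DecidableEq K] (q : ℚ) (m : ℕ) (Rset : Set ℕ)
    (M : ℕ → ℕ) (Mi : ℕ → ℕ → ℕ) (b : K) (T : ℚ → ℚ) : ℚ :=
  (∑ᶠ r ∈ Rset, (M r : ℚ) * (q ^ m - q ^ r)) * T (q ^ m / q) + levelSum q m 0 1 b T +
    ∑ᶠ r ∈ Rset, ∑ i ∈ ({1, 2} : Finset ℕ),
      (Mi r i : ℚ) * levelSum q m (r / 2) ((-1) ^ (i + 1)) b T

theorem sum_card_zeros_eq_familySum [Fintype K] [DecidableEq K] [Fintype F]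
    (hL : ∀ R ∈ L, IsTypeOne K (traceForm K R) ∨ IsTypeThree K (traceForm K R)) {q : ℚ}
    (hq : q = Fintype.card K) (b : K) (T : ℚ → ℚ) :
    ∑ R : L, ∑ β,
        T (Nat.card {x // traceForm K (R : F[X]) x + Algebra.trace K F (β * x) + b = 0}) =
      familySum q (finrank K F) (rankSet K L) (rankCount K L) (rankTypeCount K L) b T := by
  have hB (R : F[X]) (i : ℕ) (hR : HasTypeIndex K (traceForm K R) i) :=
    eq_sub_of_add_eq' (hR.sum_card_zeros hq b T).symm
  have hsum := sum_eq_add_finsum_rankTypeCount hL (B := fun r i =>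
    levelSum q (finrank K F) (r / 2) ((-1) ^ (i + 1)) b T) fun R i hR => (hB R i hR).symm
  rw [Finset.sum_sub_distrib, ← Finset.sum_mul,
    ← finsum_rankCount_mul fun r => q ^ finrank K F - q ^ r, sub_eq_iff_eq_add'] at hsum
  rw [hsum, familySum, ← add_assoc]
  norm_num

end EvenRankFamily

section WeightDistribution

open Module

theorem mul_tableRow (c weight freq : ℚ) (w : ℕ) :
    c * tableRow weight freq w = tableRow weight (c * freq) w := by
  simp [tableRow]

section Tables

variable {K : Type*} [Field K] [DecidableEq K] {q : ℕ} (m : ℕ)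

theorem levelSum_zero_one {q : ℚ} (hq : q ≠ 0) (b : K) (T : ℚ → ℚ) :
    levelSum q m 0 1 b T = T (if b = 0 then q ^ m else 0) := by
  have hqm : q ^ m / q + (q - 1) * (q ^ m / q) = q ^ m := by
    field_simp
    ring
  by_cases hb : b = 0 <;> simp [levelSum, levelCard, hb, hqm]

theorem mul_levelSum_zero (hq : q ≠ 0) {r : ℕ} (hr : Even r) (M : ℚ) (i w : ℕ) :
    M * levelSum (q : ℚ) m (r / 2) ((-1) ^ (i + 1)) (0 : K)
        (fun n => tableRow ((q : ℚ) ^ m - n) 1 w) =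
      tableRow
        ((q : ℚ) ^ m - (q : ℚ) ^ ((m : ℤ) - 1)
          + (-1) ^ i * ((q : ℚ) - 1) * (q : ℚ) ^ ((m : ℤ) - (r : ℤ) / 2 - 1))
        (M * ((q : ℚ) ^ ((r : ℤ) - 1)
          + (-1) ^ (i + 1) * ((q : ℚ) - 1) * (q : ℚ) ^ ((r : ℤ) / 2 - 1))) w
      + tableRow
        ((q : ℚ) ^ m - (q : ℚ) ^ ((m : ℤ) - 1)
          + (-1) ^ (i + 1) * (q : ℚ) ^ ((m : ℤ) - (r : ℤ) / 2 - 1))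
        (M * ((q : ℚ) ^ ((r : ℤ) - 1)
          + (-1) ^ i * (q : ℚ) ^ ((r : ℤ) / 2 - 1)) * ((q : ℚ) - 1)) w := by
  obtain ⟨h, rfl⟩ := hr.two_dvd
  have hq' : (q : ℚ) ≠ 0 := mod_cast hq
  have hhalf : ((2 * h : ℕ) : ℤ) / 2 = h := by omega
  rw [hhalf, Nat.mul_div_cancel_left h two_pos]
  simp only [levelSum, mul_add, mul_tableRow, levelCard, if_true, zpow_sub₀ hq', zpow_natCast,
    zpow_one]
  congr 2 <;> field_simp <;> ring

theorem mul_levelSum_of_ne_zero (hq : q ≠ 0) {b : K} (hb : b ≠ 0) {r : ℕ} (hr : Even r) (M : ℚ)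
    (i w : ℕ) :
    ((q : ℚ) - 1) * (M * levelSum (q : ℚ) m (r / 2) ((-1) ^ (i + 1)) b
        (fun n => tableRow ((q : ℚ) ^ m - 1 - n) 1 w)) =
      tableRow
        ((q : ℚ) ^ m - (q : ℚ) ^ ((m : ℤ) - 1) - 1
          + (-1) ^ i * ((q : ℚ) - 1) * (q : ℚ) ^ ((m : ℤ) - (r : ℤ) / 2 - 1))
        (M * ((q : ℚ) ^ ((r : ℤ) - 1)
          + (-1) ^ i * (q : ℚ) ^ ((r : ℤ) / 2 - 1)) * ((q : ℚ) - 1)) w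
      + tableRow
        ((q : ℚ) ^ m - (q : ℚ) ^ ((m : ℤ) - 1) - 1
          + (-1) ^ (i + 1) * (q : ℚ) ^ ((m : ℤ) - (r : ℤ) / 2 - 1))
        (M * ((q : ℚ) ^ r - (q : ℚ) ^ ((r : ℤ) - 1)
          + (-1) ^ (i + 1) * (q : ℚ) ^ ((r : ℤ) / 2 - 1)) * ((q : ℚ) - 1)) w := by
  obtain ⟨h, rfl⟩ := hr.two_dvd
  have hq' : (q : ℚ) ≠ 0 := mod_cast hq
  have hhalf : ((2 * h : ℕ) : ℤ) / 2 = h := by omega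
  rw [hhalf, Nat.mul_div_cancel_left h two_pos]
  simp only [levelSum, mul_add, mul_tableRow, levelCard, if_neg hb, add_zero, zpow_sub₀ hq',
    zpow_natCast, zpow_one]
  congr 2 <;> field_simp <;> ring

variable {Rset : Set ℕ} (M : ℕ → ℕ) (Mi : ℕ → ℕ → ℕ) (w : ℕ)

theorem familySum_zero (hq : q ≠ 0) (hRset : ∀ r ∈ Rset, Even r) :
    familySum (q : ℚ) m Rset M Mi (0 : K) (fun n => tableRow ((q : ℚ) ^ m - n) 1 w) =
      tableOne q m Rset M Mi w := by
  have hq' : (q : ℚ) ≠ 0 := mod_cast hq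
  have hqm : (q : ℚ) ^ m / q = (q : ℚ) ^ ((m : ℤ) - 1) := by
    rw [zpow_sub_one₀ hq', zpow_natCast, div_eq_mul_inv]
  rw [familySum, levelSum_zero_one m hq', mul_tableRow, mul_one, tableOne, if_pos rfl, sub_self,
    hqm, add_comm (tableRow _ _ _)]
  exact congrArg _ <| finsum_mem_congr rfl fun r hr => Finset.sum_congr rfl fun i _ =>
    mul_levelSum_zero m hq (hRset r hr) _ i w

theorem tableOne_add_mul_familySum (hq : q ≠ 0) (hRset : ∀ r ∈ Rset, Even r) {b : K}
    (hb : b ≠ 0) :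
    tableOne q m Rset M Mi w + ((q : ℚ) - 1) *
        familySum (q : ℚ) m Rset M Mi b (fun n => tableRow ((q : ℚ) ^ m - 1 - n) 1 w) =
      tableTwo q m Rset M Mi w := by
  have hq' : (q : ℚ) ≠ 0 := mod_cast hq
  have hqm : (q : ℚ) ^ m - 1 - (q : ℚ) ^ m / q = (q : ℚ) ^ m - (q : ℚ) ^ ((m : ℤ) - 1) - 1 := by
    rw [zpow_sub_one₀ hq', zpow_natCast, div_eq_mul_inv, sub_right_comm]
  have hrows := (mul_finsum_mem ..).trans <| finsum_mem_congr (rfl : Rset = Rset) fun r hr =>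
    (Finset.mul_sum {1, 2} _ _).trans <| Finset.sum_congr rfl fun i _ =>
      mul_levelSum_of_ne_zero m hq hb (hRset r hr) (Mi r i) i w
  rw [familySum, levelSum_zero_one m hq', mul_add, mul_add, hrows, mul_tableRow, mul_tableRow,
    mul_tableRow, mul_one, mul_one, if_neg hb, sub_zero, hqm, tableTwo]
  ring

theorem sum_familySum [Fintype K] (hq : q = Fintype.card K) (hRset : ∀ r ∈ Rset, Even r) :
    ∑ b : K, familySum (q : ℚ) m Rset M Mi b
        (fun n => tableRow ((q : ℚ) ^ m - (if b = 0 then 0 else 1) - n) 1 w) =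
      tableTwo q m Rset M Mi w := by
  have hq0 : q ≠ 0 := by simp [hq]
  have hq1 : (q : ℚ) - 1 ≠ 0 := sub_ne_zero.2 (mod_cast hq ▸ Fintype.one_lt_card.ne')
  have hcard : ((Finset.univ.erase (0 : K)).card : ℚ) = q - 1 := by
    rw [Finset.card_erase_of_mem (Finset.mem_univ _), Finset.card_univ, ← hq,
      Nat.cast_pred (Nat.pos_of_ne_zero hq0)]
  have hne (b : K) (hb : b ∈ Finset.univ.erase 0) : familySum (q : ℚ) m Rset M Mi b
      (fun n => tableRow ((q : ℚ) ^ m - (if b = 0 then 0 else 1) - n) 1 w) =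
        (tableTwo q m Rset M Mi w - tableOne q m Rset M Mi w) / (q - 1) := by
    have hb := Finset.ne_of_mem_erase hb
    rw [if_neg hb, eq_div_iff hq1, ← tableOne_add_mul_familySum m M Mi w hq0 hRset hb]
    ring
  rw [← Finset.add_sum_erase _ _ (Finset.mem_univ 0), Finset.sum_congr rfl hne, Finset.sum_const,
    nsmul_eq_mul, hcard, mul_div_cancel₀ _ hq1, if_pos rfl, sub_zero,
    familySum_zero m M Mi w hq0 hRset, add_sub_cancel]

end Tables

variable {K F : Type*} [Field K] [Field F] [Algebra K F]

theorem even_of_mem_rankSet {L : Submodule F F[X]} (hL : IsEvenRankFamily K L) {r : ℕ}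
    (hr : r ∈ rankSet K L) : Even r := by
  obtain ⟨R, hR, rfl⟩ := hr
  exact hL R hR

variable [Fintype K] {s : ℕ} {ℓ : Fin s → ℕ}

theorem isTypeOne_or_isTypeThree_traceForm [Finite F]
    (hL : IsEvenRankFamily K (linearizedSpan K F ℓ)) :
    ∀ R ∈ linearizedSpan K F ℓ, IsTypeOne K (traceForm K R) ∨ IsTypeThree K (traceForm K R) := by
  intro R hR
  have : FiniteDimensional K F := Module.Finite.of_finite
  obtain ⟨Q, hQ⟩ := exists_quadraticForm_eq_traceForm hR
  have heven := hL R hR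
  rw [← hQ] at heven ⊢
  exact isTypeOne_or_isTypeThree_of_even Q heven

variable [DecidableEq K] [Fintype F] [DecidableEq F]

theorem weightFreq_codeOne (hs : 1 ≤ s) (hℓ : Function.Injective ℓ) (hℓ_pos : ∀ i, 1 ≤ ℓ i)
    (hℓ_lt : ∀ i, 2 * ℓ i < finrank K F) (hL : IsEvenRankFamily K (linearizedSpan K F ℓ)) (w : ℕ) :
    (weightFreq (codeOne K (linearizedSpan K F ℓ)) w : ℚ) =
      tableOne (Fintype.card K) (finrank K F) (rankSet K (linearizedSpan K F ℓ))
        (rankCount K (linearizedSpan K F ℓ)) (rankTypeCount K (linearizedSpan K F ℓ)) w := by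
  have : Finite (linearizedSpan K F ℓ) := Module.finite_of_finite F
  have := Fintype.ofFinite (linearizedSpan K F ℓ)
  have hinj := (injective_codewordMap hs hℓ hℓ_pos hℓ_lt).comp
    (LinearMap.inl_injective (R := K) (M := linearizedSpan K F ℓ × F) (M₂ := K))
  rw [← range_codewordMap_comp_inl, weightFreq_range hinj, Fintype.sum_prod_type,
    ← familySum_zero (K := K) _ _ _ _ Fintype.card_ne_zero fun r => even_of_mem_rankSet hL,
    ← sum_card_zeros_eq_familySum (isTypeOne_or_isTypeThree_traceForm hL) rfl]
  refine Fintype.sum_congr _ _ fun R => Fintype.sum_congr _ _ fun β => ?_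
  change tableRow (hammingNorm (codeword K R β 0)) 1 w = _
  rw [hammingNorm_codeword, if_pos rfl, sub_zero, Module.card_eq_pow_finrank (K := K), Nat.cast_pow]

theorem weightFreq_codeTwo (hs : 1 ≤ s) (hℓ : Function.Injective ℓ) (hℓ_pos : ∀ i, 1 ≤ ℓ i)
    (hℓ_lt : ∀ i, 2 * ℓ i < finrank K F) (hL : IsEvenRankFamily K (linearizedSpan K F ℓ)) (w : ℕ) :
    (weightFreq (codeTwo K (linearizedSpan K F ℓ)) w : ℚ) =
      tableTwo (Fintype.card K) (finrank K F) (rankSet K (linearizedSpan K F ℓ))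
        (rankCount K (linearizedSpan K F ℓ)) (rankTypeCount K (linearizedSpan K F ℓ)) w := by
  have : Finite (linearizedSpan K F ℓ) := Module.finite_of_finite F
  have := Fintype.ofFinite (linearizedSpan K F ℓ)
  have hinj := injective_codewordMap hs hℓ hℓ_pos hℓ_lt
  rw [← range_codewordMap, weightFreq_range hinj, Fintype.sum_prod_type_right,
    ← sum_familySum (K := K) _ _ _ _ rfl fun r => even_of_mem_rankSet hL]
  refine Fintype.sum_congr _ _ fun b => ?_
  rw [Fintype.sum_prod_type,
    ← sum_card_zeros_eq_familySum (isTypeOne_or_isTypeThree_traceForm hL) rfl]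
  refine Fintype.sum_congr _ _ fun R => Fintype.sum_congr _ _ fun β => ?_
  change tableRow (hammingNorm (codeword K R β b)) 1 w = _
  rw [hammingNorm_codeword, Module.card_eq_pow_finrank (K := K), Nat.cast_pow]

end WeightDistribution

theorem theorem3p4 {K F : Type*} [Field K] [Fintype K] [DecidableEq K]
    [Field F] [Fintype F] [DecidableEq F] [Algebra K F]
    (q m s : ℕ) (hq : Fintype.card K = q) (hm : Module.finrank K F = m) (hs : 1 ≤ s)
    (ℓ : Fin s → ℕ) (hℓ : StrictMono ℓ) (hℓ_pos : ∀ i, 1 ≤ ℓ i) (hℓ_lt : ∀ i, 2 * ℓ i < m)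
    (hL : IsEvenRankFamily K (linearizedSpan K F ℓ)) :
    (IsCyclicCode (codeOne K (linearizedSpan K F ℓ)) ∧
      Module.finrank K (codeOne K (linearizedSpan K F ℓ)) = m * (s + 1) ∧
      ∀ w : ℕ, (weightFreq (codeOne K (linearizedSpan K F ℓ)) w : ℚ) =
        tableOne q m (rankSet K (linearizedSpan K F ℓ)) (rankCount K (linearizedSpan K F ℓ))
          (rankTypeCount K (linearizedSpan K F ℓ)) w) ∧
    (IsCyclicCode (codeTwo K (linearizedSpan K F ℓ)) ∧
      Module.finrank K (codeTwo K (linearizedSpan K F ℓ)) = m * (s + 1) + 1 ∧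
      ∀ w : ℕ, (weightFreq (codeTwo K (linearizedSpan K F ℓ)) w : ℚ) =
        tableTwo q m (rankSet K (linearizedSpan K F ℓ)) (rankCount K (linearizedSpan K F ℓ))
          (rankTypeCount K (linearizedSpan K F ℓ)) w) := by
  subst hq hm
  have hcyclic : ∀ c : F, ∀ R ∈ linearizedSpan K F ℓ, c • R.comp (C c * X) ∈ linearizedSpan K F ℓ :=
    fun c R hR => smul_comp_mem_linearizedSpan c hR
  exact ⟨⟨isCyclicCode_codeOne hcyclic, finrank_codeOne hs hℓ.injective hℓ_pos hℓ_lt,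
      weightFreq_codeOne hs hℓ.injective hℓ_pos hℓ_lt hL⟩,
    ⟨isCyclicCode_codeTwo hcyclic, finrank_codeTwo hs hℓ.injective hℓ_pos hℓ_lt,
      weightFreq_codeTwo hs hℓ.injective hℓ_pos hℓ_lt hL⟩⟩
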